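/- Let $\lambda,b,y>0$ be fixed. Let $$M(a,b,x)=\sum_{n=0}^\infty \frac{(a)_n}{(b)_n\,n!}x^n,\qquad (a)_n=a(a+1)\cdots(a+n-1),$$ be the Kummer function, and let $M'(a,b,x)=\frac{\partial}{\partial a}M(a,b,x)$ denote its derivative with respect to the first parameter. For $x>0$ denote by $0>-s_0(x)>-s_1(x)>\cdots$ the zeros of the entire function $a\mapsto M(a,b,x)$ in decreasing order (all complex zeros of this function are real, negative and simple), i.e. $s_k(x)$ is the least $r$ such that the half-plane $\mathrm{Re}\,a\ge -r$ contains at least $k+1$ of its zeros. The summands of the eigenfunction expansion $$\frac1{2\pi i}\int_{1-i\infty}^{1+i\infty}\frac{e^{\lambda s}}{s}\frac{M(s,b,y)}{M(s,b,x)}\,ds=1-\sum_{k=0}^\infty \frac{e^{-\lambda s_k(x)}}{s_k(x)}\,\frac{M(-s_k(x),b,y)}{M'(-s_k(x),b,x)}\qquad(0<y<x)$$ have the following asymptotic behavior for each fixed $k\ge 0$ as $x\to\infty$. For all sufficiently large $x$ (depending on $k$), $s_k(x)>0$, $M(-s_k(x),b,x)=0$ and $M'(-s_k(x),b,x)\neq0$,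 so that the summand is well defined, and $$\frac{e^{-\lambda s_k(x)}}{s_k(x)}\,\frac{M(-s_k(x),b,y)}{M'(-s_k(x),b,x)}= \begin{cases}1+o(1), & k=0,\\[4pt] \dfrac{(-1)^kM(-k,b,y)}{e^{\lambda k}\,k\cdot k!\,\Gamma(b)}\,x^{k+b}e^{-x}+o\big(x^{k+b}e^{-x}\big), & k\ge1.\end{cases}$$ -/

import Mathlib

open Filter Asymptotics

/-- The Kummer function `M(a,b,x) = ∑ (a)_n / ((b)_n n!) x^n`, with `(a)_n = a(a+1)⋯(a+n-1)`.
For `b` not a non-positive integer the series converges absolutely for all `a` and `x`. -/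
noncomputable def kummerM (a b x : ℂ) : ℂ :=
  ∑' n : ℕ, (ascPochhammer ℂ n).eval a / ((ascPochhammer ℂ n).eval b * (n.factorial : ℂ)) * x ^ n

/-- `M'(a,b,x)`: the derivative of the Kummer function with respect to its first parameter. -/
noncomputable def kummerMDeriv (a b x : ℂ) : ℂ :=
  deriv (fun a' : ℂ => kummerM a' b x) a

/-- The set of `a`-zeros of `M(a,b,x)` in the complex plane. -/
def kummerZeros (b x : ℝ) : Set ℂ :=
  {a : ℂ | kummerM a b x = 0}

/-- For `b, x > 0` the `a`-zeros of `M(a,b,x)` are `0 > -s_0 > -s_1 > ⋯`. The number `s_k` is the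
least `r` such that at least `k + 1` of the (complex) zeros lie in the half-plane `Re a ≥ -r`. -/
noncomputable def kummerZero (b : ℝ) (k : ℕ) (x : ℝ) : ℝ :=
  sInf {r : ℝ | ((k + 1 : ℕ) : ℕ∞) ≤ (kummerZeros b x ∩ {a : ℂ | -r ≤ a.re}).encard}

/-- The `k`-th summand `(e^{-λ s_k} / s_k) * (M(-s_k,b,y) / M'(-s_k,b,x))`, with `s_k = s_k(x)`, of
the eigenfunction expansion. -/
noncomputable def kummerSummand (lam b y : ℝ) (k : ℕ) (x : ℝ) : ℂ :=
  Complex.exp (-(lam * kummerZero b k x)) / (kummerZero b k x : ℂ) *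
    (kummerM (-(kummerZero b k x : ℂ)) b y / kummerMDeriv (-(kummerZero b k x : ℂ)) b x)

/-! Everything is read off from the normalised function f(a,x) = e^{-x} x^{b-a} M(a,b,x), whose
limit g(a) as x → ∞ is classically Γ(b)/Γ(a). The convergence is obtained without integral
representations of M: the contiguous relation gives ∂f/∂x (a,x) = (b-a) x^{-2} f(a-1,x). Starting
from a crude polynomial bound, this identity lowers the growth exponent by one at a time, until f =
O(x^{1/2}) and ∂f/∂x = O(x^{-3/2}), uniformly for a in discs. Hence f → g locally uniformly in a, g
is entire, and the a-derivatives converge as well.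

Only three facts about g are needed: g(a) = a g(a+1), g(1) = Γ(b), and g(t) ≠ 0 for real t ≥ 2. They
make the real zeros of g exactly 0, -1, -2, …, and these are simple, with g'(-k) = (-1)^k k! Γ(b). A
flux identity of Sturm–Liouville type shows that all a-zeros of M are real, and positivity of the
series makes them negative. So the zeros of M can be counted on the real line: near each -k there is
exactly one for large x, and in any bounded range there are no others. Thus s_k → k.

Linearising f at -k gives f(-k,x) ~ g'(-k)(s_k - k), so s_k - k decays like a power of x and
x^{s_k-k} → 1. At a zero, ∂f/∂a = e^{-x} x^{b+s_k} M'(-s_k,b,x). The summand is therefore x^{k+b}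
e^{-x} times a factor that converges for k ≥ 1. For k = 0 the factor 1/s_0 blows up, and f(0,x) =
x^b e^{-x} ~ Γ(b) s_0 compensates it exactly. -/

/-! ### The Kummer series: convergence, analyticity and the contiguous relation -/

/-- The coefficient of `x ^ n` in the Kummer series. -/
noncomputable def kummerCoeff (b : ℝ) (n : ℕ) (a : ℂ) : ℂ :=
  (ascPochhammer ℂ n).eval a / ((ascPochhammer ℂ n).eval (b : ℂ) * (n.factorial : ℂ))

theorem kummerM_eq (a : ℂ) (b : ℝ) (x : ℂ) : kummerM a b x = ∑' n, kummerCoeff b n a * x ^ n := rfl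

theorem ascPochhammer_ofReal_ne_zero {b : ℝ} (hb : 0 < b) (n : ℕ) :
    (ascPochhammer ℂ n).eval (b : ℂ) ≠ 0 := by
  induction n with
  | zero => simp
  | succ n ih =>
    rw [ascPochhammer_succ_eval]
    refine mul_ne_zero ih ?_
    have : (b : ℂ) + n = ((b + n : ℝ) : ℂ) := by push_cast; rfl
    rw [this]
    exact_mod_cast (by positivity : b + n ≠ 0)

/-- Each factor satisfies |a+n|/(b+n) ≤ R/b + 1. The resulting exponential majorant is uniform for a
in a disc, which is what the Weierstrass test needs for analyticity in a. -/
theorem norm_ascPochhammer_div_le {b R : ℝ} (hb : 0 < b) {a : ℂ} (ha : ‖a‖ ≤ R) (n : ℕ) :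
    ‖(ascPochhammer ℂ n).eval a / (ascPochhammer ℂ n).eval (b : ℂ)‖ ≤ (R / b + 1) ^ n := by
  have hR : 0 ≤ R := (norm_nonneg a).trans ha
  induction n with
  | zero => simp
  | succ n ih =>
    rw [ascPochhammer_succ_eval, ascPochhammer_succ_eval, mul_div_mul_comm, norm_mul, pow_succ]
    gcongr
    have h1 : ‖(b : ℂ) + n‖ = b + n := by
      have : (b : ℂ) + n = ((b + n : ℝ) : ℂ) := by push_cast; rfl
      rw [this, Complex.norm_real, Real.norm_of_nonneg (by positivity)]
    rw [norm_div, h1, div_le_iff₀ (by positivity)]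
    calc ‖a + n‖ ≤ ‖a‖ + n := by simpa using norm_add_le a (n : ℂ)
      _ ≤ R + n := by linarith
      _ ≤ (R / b + 1) * (b + n) := by
        have : (R / b + 1) * (b + n) = R + n + (R / b * n + b) := by field_simp; ring
        rw [this]
        have : 0 ≤ R / b * n + b := by positivity
        linarith

theorem norm_kummerCoeff_mul_pow_le {b R X : ℝ} (hb : 0 < b) {a x : ℂ} (ha : ‖a‖ ≤ R)
    (hx : ‖x‖ ≤ X) (n : ℕ) :
    ‖kummerCoeff b n a * x ^ n‖ ≤ ((R / b + 1) * X) ^ n / n.factorial := by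
  have hR : 0 ≤ R := (norm_nonneg a).trans ha
  rw [kummerCoeff, ← div_div, norm_mul, norm_div _ (n.factorial : ℂ), norm_pow, mul_pow,
    div_mul_eq_mul_div, Complex.norm_natCast]
  gcongr
  exact norm_ascPochhammer_div_le hb ha n

theorem summable_kummer {b : ℝ} (hb : 0 < b) (a x : ℂ) :
    Summable fun n => kummerCoeff b n a * x ^ n :=
  Summable.of_norm_bounded (Real.summable_pow_div_factorial ((‖a‖ / b + 1) * ‖x‖))
    (norm_kummerCoeff_mul_pow_le hb le_rfl le_rfl)

theorem hasSum_kummer {b : ℝ} (hb : 0 < b) (a x : ℂ) :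
    HasSum (fun n => kummerCoeff b n a * x ^ n) (kummerM a b x) :=
  (summable_kummer hb a x).hasSum

theorem norm_kummerM_le {b R X : ℝ} (hb : 0 < b) {a x : ℂ} (ha : ‖a‖ ≤ R) (hx : ‖x‖ ≤ X) :
    ‖kummerM a b x‖ ≤ Real.exp ((R / b + 1) * X) := by
  rw [Real.exp_eq_exp_ℝ]
  refine tsum_of_norm_bounded
    (NormedSpace.exp_series_hasSum_exp' (𝕂 := ℝ) ((R / b + 1) * X)) fun n => by
    simpa only [div_eq_inv_mul, smul_eq_mul, kummerCoeff] using
      norm_kummerCoeff_mul_pow_le hb ha hx n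

theorem differentiable_kummerCoeff (b : ℝ) (n : ℕ) : Differentiable ℂ (kummerCoeff b n) := by
  unfold kummerCoeff
  fun_prop

theorem differentiable_kummerM_fst {b : ℝ} (hb : 0 < b) (x : ℂ) :
    Differentiable ℂ fun a => kummerM a b x := by
  intro a
  have := Complex.differentiableOn_tsum_of_summable_norm (U := Metric.ball 0 (‖a‖ + 1))
    (F := fun n a => kummerCoeff b n a * x ^ n)
    (Real.summable_pow_div_factorial (((‖a‖ + 1) / b + 1) * ‖x‖))
    (fun n => ((differentiable_kummerCoeff b n).mul_const _).differentiableOn) Metric.isOpen_ball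
    (fun n w hw => norm_kummerCoeff_mul_pow_le hb (mem_ball_zero_iff.1 hw).le le_rfl n)
  exact this.differentiableAt (Metric.isOpen_ball.mem_nhds (by simp))

theorem kummerCoeff_add_one_mul (b : ℝ) (n : ℕ) (a : ℂ) :
    a * kummerCoeff b n (a + 1) = (a + n) * kummerCoeff b n a := by
  have h : a * (ascPochhammer ℂ n).eval (a + 1) = (a + n) * (ascPochhammer ℂ n).eval a := by
    have h1 := ascPochhammer_succ_eval n a
    rw [ascPochhammer_succ_left] at h1
    simp only [Polynomial.eval_mul, Polynomial.eval_X, Polynomial.eval_comp, Polynomial.eval_add,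
      Polynomial.eval_one] at h1
    rw [h1, mul_comm]
  rw [kummerCoeff, kummerCoeff, ← mul_div_assoc, h, mul_div_assoc]

theorem kummerCoeff_succ {b : ℝ} (hb : 0 < b) (n : ℕ) (a : ℂ) :
    (b + n) * (n + 1) * kummerCoeff b (n + 1) a = (a + n) * kummerCoeff b n a := by
  have h1 := ascPochhammer_ofReal_ne_zero hb n
  have h2 := ascPochhammer_ofReal_ne_zero hb (n + 1)
  have h3 : (n.factorial : ℂ) ≠ 0 := by exact_mod_cast n.factorial_ne_zero
  have h4 : (n : ℂ) + 1 ≠ 0 := by exact_mod_cast n.succ_ne_zero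
  rw [ascPochhammer_succ_eval] at h2
  have h5 : (b : ℂ) + n ≠ 0 := right_ne_zero_of_mul h2
  rw [kummerCoeff, kummerCoeff, ascPochhammer_succ_eval, ascPochhammer_succ_eval,
    Nat.factorial_succ]
  push_cast
  field_simp

/-- `x ∂M/∂x = a (M(a+1) - M(a))`. -/
theorem hasDerivAt_kummerM {b : ℝ} (hb : 0 < b) (a : ℂ) {x : ℂ} (hx : x ≠ 0) :
    HasDerivAt (kummerM a b) (a * (kummerM (a + 1) b x - kummerM a b x) / x) x := by
  have hs : Summable fun n : ℕ => ((‖a‖ / b + 1) * (‖x‖ + 1)) ^ n / n.factorial :=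
    Real.summable_pow_div_factorial _
  have hd : ∀ n : ℕ, DifferentiableOn ℂ (fun w : ℂ => kummerCoeff b n a * w ^ n)
      (Metric.ball 0 (‖x‖ + 1)) := fun n => by fun_prop
  have hle : ∀ (n : ℕ) (w : ℂ), w ∈ Metric.ball 0 (‖x‖ + 1) →
      ‖kummerCoeff b n a * w ^ n‖ ≤ ((‖a‖ / b + 1) * (‖x‖ + 1)) ^ n / n.factorial :=
    fun n w hw => norm_kummerCoeff_mul_pow_le hb le_rfl (mem_ball_zero_iff.1 hw).le n
  have hxm : x ∈ Metric.ball (0 : ℂ) (‖x‖ + 1) := by simp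
  have h1 := Complex.hasSum_deriv_of_summable_norm hs hd Metric.isOpen_ball hle hxm
  have h2 := (Complex.differentiableOn_tsum_of_summable_norm hs hd Metric.isOpen_ball
    hle).differentiableAt (Metric.isOpen_ball.mem_nhds hxm)
  have h3 : HasSum (fun n => deriv (fun w : ℂ => kummerCoeff b n a * w ^ n) x)
      (a * (kummerM (a + 1) b x - kummerM a b x) / x) := by
    refine ((((hasSum_kummer hb (a + 1) x).sub (hasSum_kummer hb a x)).mul_left a).div_const
      x).congr_fun fun n => ?_
    rw [deriv_const_mul_field, deriv_pow_field, mul_sub, ← mul_assoc a, kummerCoeff_add_one_mul]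
    rcases n with _ | n
    · simp
    · rw [Nat.add_sub_cancel, pow_succ]
      field_simp
      ring
  rw [h3.unique h1]
  exact h2.hasDerivAt

theorem differentiable_kummerM {b : ℝ} (hb : 0 < b) (a : ℂ) : Differentiable ℂ (kummerM a b) := by
  intro x
  have := Complex.differentiableOn_tsum_of_summable_norm (U := Metric.ball 0 (‖x‖ + 1))
    (F := fun n x => kummerCoeff b n a * x ^ n)
    (Real.summable_pow_div_factorial ((‖a‖ / b + 1) * (‖x‖ + 1)))
    (fun n => by fun_prop) Metric.isOpen_ball
    (fun n w hw => norm_kummerCoeff_mul_pow_le hb le_rfl (mem_ball_zero_iff.1 hw).le n)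
  exact this.differentiableAt (Metric.isOpen_ball.mem_nhds (by simp))

/-- Comparing coefficients of x^{n+1}; this three-term relation replaces Kummer's differential
equation throughout. -/
theorem kummerM_contiguous {b : ℝ} (hb : 0 < b) (a x : ℂ) :
    (b - a) * kummerM (a - 1) b x + (2 * a - b + x) * kummerM a b x
      = a * kummerM (a + 1) b x := by
  have h0 := (hasSum_kummer hb (a - 1) x).mul_left (b - a)
  have h1 := (hasSum_kummer hb a x).mul_left (2 * a - b)
  have h2 := (hasSum_kummer hb (a + 1) x).mul_left a
  have h3 := (hasSum_kummer hb a x).mul_left x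
  have h4 := (h2.sub h0).sub h1
  -- The constant term is a - (b-a) - (2a-b) = 0, so removing it makes the index shift match the
  -- factor x.
  rw [← hasSum_nat_add_iff' 1] at h4
  have key : ∀ n : ℕ, a * (kummerCoeff b (n + 1) (a + 1) * x ^ (n + 1))
      - (b - a) * (kummerCoeff b (n + 1) (a - 1) * x ^ (n + 1))
      - (2 * a - b) * (kummerCoeff b (n + 1) a * x ^ (n + 1))
      = x * (kummerCoeff b n a * x ^ n) := by
    intro n
    have e1 := kummerCoeff_add_one_mul b (n + 1) a
    have e2 := kummerCoeff_add_one_mul b n (a - 1)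
    have e3 := kummerCoeff_succ hb n a
    have e4 := kummerCoeff_succ hb n (a - 1)
    have h2 := ascPochhammer_ofReal_ne_zero hb (n + 1)
    rw [ascPochhammer_succ_eval] at h2
    have h5 : (b : ℂ) + n ≠ 0 := right_ne_zero_of_mul h2
    have h6 : (n : ℂ) + 1 ≠ 0 := by exact_mod_cast n.succ_ne_zero
    rw [sub_add_cancel] at e2
    push_cast at e1
    have e5 : a * kummerCoeff b (n + 1) (a + 1) - (b - a) * kummerCoeff b (n + 1) (a - 1)
        - (2 * a - b) * kummerCoeff b (n + 1) a = kummerCoeff b n a := by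
      -- After multiplication by (b+n)(n+1), the recursions in n and in a reduce every term to a
      -- multiple of the n-th coefficient at a.
      refine mul_left_cancel₀ (mul_ne_zero h5 h6) ?_
      linear_combination (b + n) * (n + 1) * e1 + ((n + 1) + b - a) * e3 - (b - a) * e4
        + (b - a) * e2
    rw [← e5]; ring
  simp only [key] at h4
  have h6 := h4.unique h3
  simp [kummerCoeff] at h6
  linear_combination -h6

theorem kummerM_zero_fst (b : ℝ) (x : ℂ) : kummerM 0 b x = 1 := by
  rw [kummerM, tsum_eq_single 0]
  · simp
  · intro n hn
    simp [hn]

theorem kummerM_zero_right (a : ℂ) (b : ℝ) : kummerM a b 0 = 1 := by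
  rw [kummerM, tsum_eq_single 0]
  · simp
  · intro n hn
    simp [hn]

theorem kummerM_self {b : ℝ} (hb : 0 < b) (x : ℂ) : kummerM b b x = Complex.exp x := by
  rw [Complex.exp_eq_exp_ℂ, NormedSpace.exp_eq_tsum_div (𝔸 := ℂ)]
  refine tsum_congr fun n => ?_
  have := ascPochhammer_ofReal_ne_zero hb n
  field_simp

theorem kummerM_one_eq {b : ℝ} (hb : 0 < b) (x : ℂ) :
    kummerM 1 b x = 1 + x / b * kummerM 1 ((b + 1 : ℝ) : ℂ) x := by
  rw [kummerM_eq, kummerM_eq, (summable_kummer hb 1 x).tsum_eq_zero_add, ← tsum_mul_left]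
  congr 1
  · simp [kummerCoeff]
  · refine tsum_congr fun n => ?_
    have hb' : (b : ℂ) ≠ 0 := by exact_mod_cast hb.ne'
    have h1 := ascPochhammer_ofReal_ne_zero (by linarith : 0 < b + 1) n
    have h2 : (ascPochhammer ℂ (n + 1)).eval (b : ℂ)
        = b * (ascPochhammer ℂ n).eval ((b + 1 : ℝ) : ℂ) := by
      rw [ascPochhammer_succ_left]
      simp
    have h3 : (n.factorial : ℂ) ≠ 0 := by exact_mod_cast n.factorial_ne_zero
    have h4 : ((n + 1).factorial : ℂ) ≠ 0 := by exact_mod_cast (n + 1).factorial_ne_zero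
    rw [kummerCoeff, kummerCoeff, h2, ascPochhammer_eval_one, ascPochhammer_eval_one]
    field_simp
    ring

/-! ### Real parameters: positivity and monotonicity in a -/

/-- The Kummer function of real arguments. -/
noncomputable def kummerReal (a b x : ℝ) : ℝ :=
  ∑' n : ℕ, (ascPochhammer ℝ n).eval a / ((ascPochhammer ℝ n).eval b * (n.factorial : ℝ)) * x ^ n

theorem ascPochhammer_eval_ofReal (n : ℕ) (a : ℝ) :
    (ascPochhammer ℂ n).eval (a : ℂ) = ((ascPochhammer ℝ n).eval a : ℝ) := by
  rw [← ascPochhammer_map (algebraMap ℝ ℂ), ← Complex.coe_algebraMap, Polynomial.eval_map_algebraMap,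
    Polynomial.aeval_algebraMap_apply]
  simp

theorem kummerM_ofReal (a b x : ℝ) : kummerM a b x = (kummerReal a b x : ℂ) := by
  rw [kummerM, kummerReal, Complex.ofReal_tsum]
  refine tsum_congr fun n => ?_
  push_cast [ascPochhammer_eval_ofReal]
  rfl

theorem ascPochhammer_eval_mono (n : ℕ) {a a' : ℝ} (ha : 0 ≤ a) (h : a ≤ a') :
    (ascPochhammer ℝ n).eval a ≤ (ascPochhammer ℝ n).eval a' ∧ 0 ≤ (ascPochhammer ℝ n).eval a := by
  induction n with
  | zero => simp
  | succ n ih =>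
    rw [ascPochhammer_succ_eval, ascPochhammer_succ_eval]
    obtain ⟨h1, h2⟩ := ih
    constructor
    · gcongr
      exact h2.trans h1
    · positivity

theorem summable_kummerReal {b : ℝ} (hb : 0 < b) (a x : ℝ) :
    Summable fun n : ℕ => (ascPochhammer ℝ n).eval a /
      ((ascPochhammer ℝ n).eval b * (n.factorial : ℝ)) * x ^ n := by
  have := summable_kummer hb a x
  rw [← Complex.summable_ofReal]
  convert this using 2 with n
  push_cast [kummerCoeff, ascPochhammer_eval_ofReal]
  rfl

theorem kummerReal_mono {a a' b x : ℝ} (hb : 0 < b) (hx : 0 ≤ x) (ha : 0 ≤ a) (h : a ≤ a') :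
    kummerReal a b x ≤ kummerReal a' b x := by
  refine (summable_kummerReal hb a x).tsum_le_tsum (fun n => ?_) (summable_kummerReal hb a' x)
  have := (ascPochhammer_eval_mono n hb.le le_rfl).2
  have := (ascPochhammer_eval_mono n ha h).1
  gcongr

theorem one_le_kummerReal {a b x : ℝ} (hb : 0 < b) (hx : 0 ≤ x) (ha : 0 ≤ a) :
    1 ≤ kummerReal a b x := by
  have h := kummerReal_mono hb hx le_rfl ha
  have h1 : kummerReal 0 b x = 1 := by
    have := kummerM_zero_fst b x
    rw [← Complex.ofReal_zero, kummerM_ofReal] at this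
    exact_mod_cast this
  rwa [h1] at h

theorem kummerReal_contiguous {b : ℝ} (hb : 0 < b) (a x : ℝ) :
    (b - a) * kummerReal (a - 1) b x + (2 * a - b + x) * kummerReal a b x
      = a * kummerReal (a + 1) b x := by
  have := kummerM_contiguous hb a x
  rw [show (a : ℂ) - 1 = ((a - 1 : ℝ) : ℂ) by push_cast; rfl,
    show (a : ℂ) + 1 = ((a + 1 : ℝ) : ℂ) by push_cast; rfl] at this
  simp only [kummerM_ofReal] at this
  exact_mod_cast this

/-- Termwise, |(a)_n| ≤ (R)_n. -/
theorem norm_kummerM_le_kummerReal {b R x : ℝ} (hb : 0 < b) (hx : 0 ≤ x) {a : ℂ} (ha : ‖a‖ ≤ R) :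
    ‖kummerM a b x‖ ≤ kummerReal R b x := by
  refine tsum_of_norm_bounded (summable_kummerReal hb R x).hasSum fun n => ?_
  have hbn := (ascPochhammer_eval_mono n hb.le le_rfl).2
  rw [norm_mul, norm_div, norm_mul, norm_pow, Complex.norm_natCast, ascPochhammer_eval_ofReal,
    Complex.norm_real, Complex.norm_real, Real.norm_of_nonneg hbn, Real.norm_of_nonneg hx]
  gcongr
  clear hbn
  induction n with
  | zero => simp
  | succ n ih =>
    rw [ascPochhammer_succ_eval, ascPochhammer_succ_eval, norm_mul]
    gcongr
    · exact (norm_nonneg _).trans ih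
    · calc ‖a + n‖ ≤ ‖a‖ + n := by simpa using norm_add_le a (n : ℂ)
        _ ≤ R + n := by linarith

/-! ### The zeros are real and negative -/

theorem hasDerivAt_kummerM_ofReal {b : ℝ} (hb : 0 < b) (a : ℂ) {x : ℝ} (hx : 0 < x) :
    HasDerivAt (fun t : ℝ => kummerM a b t) (a * (kummerM (a + 1) b x - kummerM a b x) / x) x :=
  (hasDerivAt_kummerM hb a (by exact_mod_cast hx.ne')).comp_ofReal

/-- The contiguous relation at a+1 eliminates M(a+2), so M(a) and M(a+1) satisfy a closed
first-order system in x. -/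
theorem hasDerivAt_kummerM_add_one {b : ℝ} (hb : 0 < b) (a : ℂ) {x : ℝ} (hx : 0 < x) :
    HasDerivAt (fun t : ℝ => kummerM (a + 1) b t)
      (((b - a - 1) * kummerM a b x + (a + 1 - b + x) * kummerM (a + 1) b x) / x) x := by
  convert hasDerivAt_kummerM_ofReal hb (a + 1) hx using 2
  have := kummerM_contiguous hb (a + 1) x
  rw [add_sub_cancel_right] at this
  linear_combination this

/-- For `w = M(a,b,·)` and `p = x^b e^{-x}`: `(Im (p w' conj w))' = Im a · x^{b-1} e^{-x} |w|²`. -/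
theorem hasDerivAt_im_kummer_flux {b : ℝ} (hb : 0 < b) (a : ℂ) {x : ℝ} (hx : 0 < x) :
    HasDerivAt (fun t : ℝ => t ^ (b - 1) * Real.exp (-t) *
        (a * (kummerM (a + 1) b t - kummerM a b t) * starRingEnd ℂ (kummerM a b t)).im)
      (a.im * (x ^ (b - 1) * Real.exp (-x) * Complex.normSq (kummerM a b x))) x := by
  have h1 := hasDerivAt_kummerM_ofReal hb a hx
  have h2 := hasDerivAt_kummerM_add_one hb a hx
  have h3 : HasDerivAt (fun t : ℝ => starRingEnd ℂ (kummerM a b t))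
      (starRingEnd ℂ (a * (kummerM (a + 1) b x - kummerM a b x) / x)) x := h1.star
  have h4 := Complex.imCLM.hasFDerivAt.comp_hasDerivAt x (((h2.sub h1).const_mul a).mul h3)
  have h5 : HasDerivAt (fun t : ℝ => t ^ (b - 1) * Real.exp (-t))
      (x ^ (b - 1) * Real.exp (-x) * ((b - 1) / x - 1)) x := by
    refine ((Real.hasDerivAt_rpow_const (p := b - 1) (Or.inl hx.ne')).mul
      ((Real.hasDerivAt_exp (-x)).comp x (hasDerivAt_neg x))).congr_deriv ?_
    rw [Real.rpow_sub_one hx.ne']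
    simp
    ring
  refine (h5.mul h4).congr_deriv ?_
  simp only [Complex.imCLM_apply, Function.comp, Pi.mul_apply, Pi.sub_apply]
  generalize kummerM (a + 1) b x = u
  generalize kummerM a b x = v
  have e : ∀ z : ℂ, (z / (x : ℂ)).im = z.im / x := fun z => Complex.div_ofReal_im z x
  have e' : ∀ z : ℂ, (z / (x : ℂ)).re = z.re / x := fun z => Complex.div_ofReal_re z x
  simp only [Complex.mul_im, Complex.sub_im, Complex.sub_re, Complex.mul_re, Complex.add_im,
    Complex.add_re, e, e', Complex.conj_re, Complex.conj_im, Complex.normSq_apply,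
    Complex.ofReal_re, Complex.ofReal_im, Complex.one_re, Complex.one_im]
  field_simp
  ring

/-- If Im a ≠ 0, the flux divided by Im a is nondecreasing and vanishes both at 0 and at the zero x.
It is then constant, so |M(a,b,t)|² = 0 on (0,x), which contradicts M(a,b,0) = 1. -/
theorem im_eq_zero_of_kummerM_eq_zero {b x : ℝ} (hb : 0 < b) (hx : 0 < x) {a : ℂ}
    (h : kummerM a b x = 0) : a.im = 0 := by
  by_contra him
  set w : ℝ → ℂ := fun t => kummerM a b t with hw
  have hwc : Continuous w := (differentiable_kummerM hb a).continuous.comp Complex.continuous_ofReal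
  set F : ℝ → ℝ := fun t => a.im⁻¹ * (t ^ (b - 1) * Real.exp (-t) *
    (a * (kummerM (a + 1) b t - kummerM a b t) * starRingEnd ℂ (kummerM a b t)).im) with hF
  have hderiv : ∀ t : ℝ, 0 < t →
      HasDerivAt F (t ^ (b - 1) * Real.exp (-t) * Complex.normSq (w t)) t := fun t ht =>
    ((hasDerivAt_im_kummer_flux hb a ht).const_mul a.im⁻¹).congr_deriv (by
      rw [← mul_assoc, inv_mul_cancel₀ him, one_mul])
  -- The difference M(a+1) - M(a) vanishes at 0, so the value assigned to 0^(b-1) is irrelevant.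
  have hF0 : F 0 = 0 := by simp [hF, kummerM_zero_right]
  have hFx : F x = 0 := by simp [hF, h]
  have hcont0 : ContinuousWithinAt F (Set.Icc 0 x) 0 := by
    rw [ContinuousWithinAt, hF0]
    -- Since M(a+1) - M(a) = O(t), the flux is O(t^b) at 0, which tends to 0 even when t^{b-1} is
    -- singular.
    have hd : DifferentiableAt ℂ (fun z => kummerM (a + 1) b z - kummerM a b z) 0 :=
      ((differentiable_kummerM hb (a + 1)).sub (differentiable_kummerM hb a)) 0
    obtain ⟨C, hC⟩ := hd.isBigO_sub.bound
    have hC' : ∀ᶠ t : ℝ in nhds 0,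
        ‖kummerM (a + 1) b t - kummerM a b t‖ ≤ C * ‖(t : ℂ)‖ := by
      have : Tendsto (fun t : ℝ => (t : ℂ)) (nhds 0) (nhds 0) := by
        simpa using Complex.continuous_ofReal.tendsto 0
      simpa [kummerM_zero_right] using this.eventually hC
    have hlim : Tendsto (fun t : ℝ => |a.im⁻¹| * (t ^ b * Real.exp (-t) *
        (‖a‖ * C * ‖w t‖))) (nhdsWithin 0 (Set.Icc 0 x)) (nhds 0) := by
      have hc : Continuous (fun t : ℝ => |a.im⁻¹| * (t ^ b * Real.exp (-t) *
        (‖a‖ * C * ‖w t‖))) := by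
        have := Real.continuous_rpow_const hb.le
        fun_prop
      simpa [Real.zero_rpow hb.ne'] using (hc.tendsto 0).mono_left nhdsWithin_le_nhds
    refine squeeze_zero_norm' ?_ hlim
    filter_upwards [self_mem_nhdsWithin, nhdsWithin_le_nhds hC'] with t ht htC
    rcases ht.1.eq_or_lt with rfl | ht0
    · simp [hF0, Real.zero_rpow hb.ne']
    · have hp : t ^ b = t ^ (b - 1) * t := by
        rw [← Real.rpow_add_one ht0.ne', sub_add_cancel]
      simp only [hF, norm_mul, Real.norm_eq_abs, abs_of_pos (Real.exp_pos _),
        abs_of_pos (Real.rpow_pos_of_pos ht0 (b - 1)), hp]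
      rw [Complex.norm_real, Real.norm_of_nonneg ht0.le] at htC
      calc |a.im⁻¹| * (t ^ (b - 1) * Real.exp (-t) *
            |(a * (kummerM (a + 1) b t - kummerM a b t) * starRingEnd ℂ (kummerM a b t)).im|)
          ≤ |a.im⁻¹| * (t ^ (b - 1) * Real.exp (-t) * (‖a‖ * (C * t) * ‖w t‖)) := by
            gcongr
            refine (Complex.abs_im_le_norm _).trans ?_
            rw [norm_mul, norm_mul, RCLike.norm_conj]
            gcongr
        _ = _ := by ring
  have hcont : ContinuousOn F (Set.Icc 0 x) := by
    intro t ht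
    rcases ht.1.eq_or_lt with rfl | ht0
    · exact hcont0
    · exact (hderiv t ht0).continuousAt.continuousWithinAt
  have hmono : MonotoneOn F (Set.Icc 0 x) := by
    refine monotoneOn_of_deriv_nonneg (convex_Icc 0 x) hcont ?_ ?_
    · rw [interior_Icc]
      exact fun t ht => (hderiv t ht.1).differentiableAt.differentiableWithinAt
    · rw [interior_Icc]
      intro t ht
      rw [(hderiv t ht.1).deriv]
      have := Complex.normSq_nonneg (w t)
      have := Real.rpow_nonneg ht.1.le (b - 1)
      positivity
  have hzero : ∀ t ∈ Set.Icc 0 x, F t = 0 := fun t ht => le_antisymm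
    (hFx ▸ hmono ht (Set.right_mem_Icc.2 hx.le) ht.2) (hF0 ▸ hmono (Set.left_mem_Icc.2 hx.le) ht ht.1)
  have hw0 : ∀ t ∈ Set.Ioo 0 x, w t = 0 := by
    intro t ht
    have h1 : F =ᶠ[nhds t] fun _ => 0 := by
      filter_upwards [isOpen_Ioo.mem_nhds ht] with u hu
      exact hzero u (Set.Ioo_subset_Icc_self hu)
    have h2 := (hderiv t ht.1).unique ((hasDerivAt_const t (0 : ℝ)).congr_of_eventuallyEq h1)
    have := (Real.rpow_pos_of_pos ht.1 (b - 1)).ne'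
    have := (Real.exp_pos (-t)).ne'
    simpa [*] using h2
  have h1 : Set.EqOn w 0 (closure (Set.Ioo 0 x)) := Set.EqOn.closure hw0 hwc continuous_zero
  have h2 := h1 (by rw [closure_Ioo hx.ne]; exact Set.left_mem_Icc.2 hx.le : (0 : ℝ) ∈ _)
  simp [hw, kummerM_zero_right] at h2

theorem kummerM_eq_zero {b x : ℝ} (hb : 0 < b) (hx : 0 < x) {a : ℂ}
    (h : kummerM a b x = 0) : a.im = 0 ∧ a.re < 0 := by
  have him := im_eq_zero_of_kummerM_eq_zero hb hx h
  refine ⟨him, ?_⟩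
  by_contra! hre
  have h1 : a = (a.re : ℂ) := Complex.ext rfl him
  rw [h1, kummerM_ofReal] at h
  have := one_le_kummerReal hb hx.le hre
  rw [Complex.ofReal_eq_zero.1 h] at this
  linarith

/-! ### The normalised function and its growth in x -/

/-- The normalised Kummer function `e^{-x} x^{b-a} M(a,b,x)`, which tends to `Γ(b)/Γ(a)`. -/
noncomputable def kummerNormalized (b : ℝ) (a : ℂ) (x : ℝ) : ℂ :=
  Complex.exp (-x) * (x : ℂ) ^ ((b : ℂ) - a) * kummerM a b x

theorem norm_kummerNormalized (b : ℝ) (a : ℂ) {x : ℝ} (hx : 0 < x) :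
    ‖kummerNormalized b a x‖ = Real.exp (-x) * x ^ (b - a.re) * ‖kummerM a b x‖ := by
  rw [kummerNormalized, norm_mul, norm_mul, Complex.norm_cpow_eq_rpow_re_of_pos hx,
    Complex.norm_exp]
  simp

/-- With this prefactor the contiguous relation cancels everything except M(a-1). The gain of x^{-2}
drives both the improvement of the bounds and the convergence. -/
theorem hasDerivAt_kummerNormalized {b : ℝ} (hb : 0 < b) (a : ℂ) {x : ℝ} (hx : 0 < x) :
    HasDerivAt (kummerNormalized b a) ((b - a) / x ^ 2 * kummerNormalized b (a - 1) x) x := by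
  have hx0 : (x : ℂ) ≠ 0 := by exact_mod_cast hx.ne'
  have hs : (x : ℂ) ∈ Complex.slitPlane := Complex.ofReal_mem_slitPlane.2 hx
  have h1 : HasDerivAt (fun z : ℂ => Complex.exp (-z)) (-Complex.exp (-x)) (x : ℂ) := by
    simpa using (hasDerivAt_neg (x : ℂ)).cexp
  have h2 : HasDerivAt (fun z : ℂ => z ^ ((b : ℂ) - a)) ((b - a) * (x : ℂ) ^ ((b : ℂ) - a - 1))
      (x : ℂ) := by
    simpa using (hasDerivAt_id (x : ℂ)).cpow_const (c := (b : ℂ) - a) hs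
  have h3 := ((h1.mul h2).mul (hasDerivAt_kummerM hb a hx0)).comp_ofReal
  refine h3.congr_deriv ?_
  have h4 := kummerM_contiguous hb a x
  simp only [kummerNormalized, Pi.mul_apply]
  rw [show (b : ℂ) - (a - 1) = b - a + 1 by ring, Complex.cpow_add _ _ hx0,
    Complex.cpow_sub ((b : ℂ) - a) 1 hx0, Complex.cpow_one]
  generalize (x : ℂ) ^ ((b : ℂ) - a) = P
  field_simp
  linear_combination -P * h4

/-- Comparison with an explicit majorant B, used in place of integrating derivative bounds. -/
theorem norm_le_of_norm_deriv_le {u u' : ℝ → ℂ} {B B' : ℝ → ℝ} {X : ℝ}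
    (hu : ∀ x, X ≤ x → HasDerivAt u (u' x) x) (hB : ∀ x, X ≤ x → HasDerivAt B (B' x) x)
    (h0 : ‖u X‖ ≤ B X) (h : ∀ x, X ≤ x → ‖u' x‖ ≤ B' x) {x : ℝ} (hx : X ≤ x) : ‖u x‖ ≤ B x :=
  image_norm_le_of_norm_deriv_right_le_deriv_boundary' (a := X) (b := x)
    (fun t ht => (hu t ht.1).continuousAt.continuousWithinAt)
    (fun t ht => (hu t ht.1).hasDerivWithinAt) h0
    (fun t ht => (hB t ht.1).continuousAt.continuousWithinAt)
    (fun t ht => (hB t ht.1).hasDerivWithinAt) (fun t ht => h t ht.1) (Set.right_mem_Icc.2 hx)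

/-- Induction from M(b,b,x) = e^x: in the contiguous relation at b+m the term -m M(b+m-1) is
nonpositive and is dropped, so each step costs one factor x. -/
theorem kummerReal_add_nat_le {b : ℝ} (hb : 0 < b) (m : ℕ) :
    ∃ C : ℝ, 0 ≤ C ∧ ∀ x : ℝ, 1 ≤ x → kummerReal (b + m) b x ≤ C * x ^ m * Real.exp x := by
  induction m with
  | zero =>
    refine ⟨1, zero_le_one, fun x hx => ?_⟩
    have := kummerM_self hb x
    rw [kummerM_ofReal, ← Complex.ofReal_exp] at this
    have := Complex.ofReal_injective this
    simp [this]
  | succ m ih =>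
    obtain ⟨C, hC, h⟩ := ih
    refine ⟨(b + 2 * m + 1) / (b + m) * C, by positivity, fun x hx => ?_⟩
    have h1 := kummerReal_contiguous hb (b + m) x
    have h2 := h x hx
    have h3 : 0 ≤ (m : ℝ) * kummerReal (b + m - 1) b x := by
      rcases m with _ | m
      · simp
      · have := one_le_kummerReal (a := b + (m + 1 : ℕ) - 1) hb (by linarith : 0 ≤ x)
          (by push_cast; have : (0 : ℝ) ≤ m := m.cast_nonneg
              linarith)
        positivity
    have h4 : (0 : ℝ) < b + m := by positivity
    have h0 : 0 ≤ kummerReal (b + m) b x :=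
      zero_le_one.trans (one_le_kummerReal hb (by linarith) h4.le)
    push_cast
    rw [← add_assoc]
    have h5 : (b + m) * kummerReal (b + m + 1) b x ≤ (b + 2 * m + 1) * x * kummerReal (b + m) b x := by
      have : (2 * (b + m) - b + x) * kummerReal (b + m) b x
          ≤ (b + 2 * m + 1) * x * kummerReal (b + m) b x := by
        gcongr
        have : (0 : ℝ) ≤ (b + 2 * m) * (x - 1) := by
          have : 0 ≤ x - 1 := by linarith
          positivity
        linarith
      linarith
    have h6 : (b + m) * kummerReal (b + m + 1) b x
        ≤ (b + 2 * m + 1) * x * (C * x ^ m * Real.exp x) := h5.trans (by gcongr)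
    rw [pow_succ, div_mul_eq_mul_div, div_mul_eq_mul_div, div_mul_eq_mul_div, le_div_iff₀ h4]
    linarith

/-- `f(a - j, x) = O(x^q)` uniformly for `|a| ≤ R`, where `f` is the normalised function. -/
def KummerBound (b R : ℝ) (j : ℕ) (q : ℝ) : Prop :=
  ∃ C X : ℝ, 0 ≤ C ∧ 1 ≤ X ∧ ∀ a : ℂ, ‖a‖ ≤ R → ∀ x : ℝ, X ≤ x →
    ‖kummerNormalized b (a - j) x‖ ≤ C * x ^ q

theorem exists_kummerBound {b R : ℝ} (hb : 0 < b) (hR : 0 ≤ R) :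
    ∃ q : ℝ, 0 ≤ q ∧ KummerBound b R 0 q := by
  obtain ⟨m, hm⟩ := exists_nat_ge R
  obtain ⟨C, hC, h⟩ := kummerReal_add_nat_le hb m
  refine ⟨b + R + m, by positivity, C, 1, hC, le_rfl, fun a ha x hx => ?_⟩
  have hx0 : 0 < x := by linarith
  rw [Nat.cast_zero, sub_zero, norm_kummerNormalized b a hx0]
  have h1 : ‖kummerM a b x‖ ≤ C * x ^ m * Real.exp x :=
    (norm_kummerM_le_kummerReal hb hx0.le (by linarith : ‖a‖ ≤ b + m)).trans (h x hx)
  have h2 : x ^ (b - a.re) ≤ x ^ (b + R) := by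
    apply Real.rpow_le_rpow_of_exponent_le hx
    have := (abs_le.1 (Complex.abs_re_le_norm a)).1
    linarith
  calc Real.exp (-x) * x ^ (b - a.re) * ‖kummerM a b x‖
      ≤ Real.exp (-x) * x ^ (b + R) * (C * x ^ m * Real.exp x) := by gcongr
    _ = C * x ^ (b + R + m) := by
      rw [Real.rpow_add_natCast hx0.ne', Real.exp_neg]
      field_simp

/-- Lowering a by one does not worsen the exponent: the derivative of t^a M(a,b,t) is a t^{a-1}
M(a+1,b,t), and the bound on M(a+1) makes this O(e^t t^s) with s = 2 Re a - b + q. Integration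
against e^t preserves that order. -/
theorem KummerBound.succ {b R q : ℝ} {j : ℕ} (hb : 0 < b) (hR : 0 ≤ R) (hq : 0 ≤ q)
    (h : KummerBound b R j q) : KummerBound b R (j + 1) q := by
  obtain ⟨C, X, hC, hX, h⟩ := h
  set R' : ℝ := R + j + 1 with hR'
  have hR'0 : 0 ≤ R' := by positivity
  set S : ℝ := 2 * R' + b + q with hS
  -- Beyond 2S one has s t^{s-1} ≥ -t^s/2, so the derivative of K e^t t^s keeps at least half of its
  -- leading term.
  set Y : ℝ := max X (2 * S) with hY
  have hY1 : 1 ≤ Y := hX.trans (le_max_left _ _)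
  have hY0 : 0 < Y := by linarith
  set K0 : ℝ := Real.exp ((R' / b + 1) * Y) * Y ^ (R' + b) with hK0
  have hK0' : 0 ≤ K0 := by positivity
  -- The part 2CR' dominates the derivative, despite the lost factor 1/2; the part K0 dominates the
  -- initial value at Y.
  set K : ℝ := 2 * C * R' + K0 with hK
  have hK' : 0 ≤ K := by positivity
  refine ⟨K, Y, hK', hY1, fun a₀ ha₀ x hx => ?_⟩
  set a : ℂ := a₀ - (j + 1 : ℕ) with ha
  have haR : ‖a‖ ≤ R' := by
    calc ‖a‖ ≤ ‖a₀‖ + ‖((j + 1 : ℕ) : ℂ)‖ := norm_sub_le _ _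
      _ ≤ R' := by rw [Complex.norm_natCast]; push_cast; linarith
  have ha1 : a + 1 = a₀ - j := by rw [ha]; push_cast; ring
  set σ := a.re with hσ
  have hσR := abs_le.1 ((Complex.abs_re_le_norm a).trans haR)
  set s : ℝ := 2 * σ - b + q with hs
  have hsS : |s| ≤ S := abs_le.2 ⟨by linarith, by linarith⟩
  have hpos : ∀ t, Y ≤ t → 0 < t := fun t ht => hY0.trans_le ht
  have hu : ∀ t, Y ≤ t → HasDerivAt (fun t : ℝ => (t : ℂ) ^ a * kummerM a b t)
      (a * (t : ℂ) ^ (a - 1) * kummerM (a + 1) b t) t := by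
    intro t ht
    have ht0 : (t : ℂ) ≠ 0 := by exact_mod_cast (hpos t ht).ne'
    have h2 : HasDerivAt (fun z : ℂ => z ^ a) (a * (t : ℂ) ^ (a - 1)) (t : ℂ) := by
      simpa using (hasDerivAt_id (t : ℂ)).cpow_const (c := a)
        (Complex.ofReal_mem_slitPlane.2 (hpos t ht))
    refine (h2.mul (hasDerivAt_kummerM hb a ht0)).comp_ofReal.congr_deriv ?_
    rw [Complex.cpow_sub _ _ ht0, Complex.cpow_one]
    field_simp
    ring
  have hB : ∀ t, Y ≤ t → HasDerivAt (fun t : ℝ => K * (Real.exp t * t ^ s))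
      (K * (Real.exp t * t ^ s + Real.exp t * (s * t ^ (s - 1)))) t := fun t ht =>
    ((Real.hasDerivAt_exp t).mul (Real.hasDerivAt_rpow_const (Or.inl (hpos t ht).ne'))).const_mul K
  have hbd := norm_le_of_norm_deriv_le hu hB ?_ ?_ hx
  · have hx0 := hpos x hx
    rw [norm_mul, Complex.norm_cpow_eq_rpow_re_of_pos hx0] at hbd
    rw [norm_kummerNormalized b a hx0]
    calc Real.exp (-x) * x ^ (b - σ) * ‖kummerM a b x‖
        = Real.exp (-x) * x ^ (b - 2 * σ) * (x ^ σ * ‖kummerM a b x‖) := by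
          rw [show b - σ = b - 2 * σ + σ by ring, Real.rpow_add hx0]; ring
      _ ≤ Real.exp (-x) * x ^ (b - 2 * σ) * (K * (Real.exp x * x ^ s)) := by gcongr
      _ = K * x ^ q := by
          have h1 : x ^ (b - 2 * σ) * x ^ s = x ^ q := by
            rw [← Real.rpow_add hx0, hs]; congr 1; ring
          rw [← h1, Real.exp_neg]
          field_simp
  · rw [norm_mul, Complex.norm_cpow_eq_rpow_re_of_pos hY0]
    have h1 : ‖kummerM a b Y‖ ≤ Real.exp ((R' / b + 1) * Y) :=
      norm_kummerM_le hb haR (by simp [abs_of_pos hY0])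
    have h2 : Y ^ σ ≤ Y ^ (R' + b) * Y ^ s := by
      rw [← Real.rpow_add hY0]
      exact Real.rpow_le_rpow_of_exponent_le hY1 (by linarith)
    have h3 : 1 ≤ Real.exp Y := Real.one_le_exp hY0.le
    calc Y ^ σ * ‖kummerM a b Y‖
        ≤ (Y ^ (R' + b) * Y ^ s) * Real.exp ((R' / b + 1) * Y) := by gcongr
      _ = K0 * (1 * Y ^ s) := by rw [hK0]; ring
      _ ≤ K * (Real.exp Y * Y ^ s) := by
        gcongr
        rw [hK]
        have : 0 ≤ 2 * C * R' := by positivity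
        linarith
  · intro t ht
    have ht0 := hpos t ht
    have h1 := h a₀ ha₀ t ((le_max_left _ _).trans ht)
    rw [← ha1, norm_kummerNormalized b _ ht0, Complex.add_re, Complex.one_re] at h1
    rw [norm_mul, norm_mul, Complex.norm_cpow_eq_rpow_re_of_pos ht0, Complex.sub_re, Complex.one_re]
    have h2 : ‖kummerM (a + 1) b t‖ ≤ Real.exp t * t ^ (σ + 1 - b) * (C * t ^ q) := by
      calc ‖kummerM (a + 1) b t‖ = Real.exp t * t ^ (σ + 1 - b) *
            (Real.exp (-t) * t ^ (b - (σ + 1)) * ‖kummerM (a + 1) b t‖) := by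
            rw [show σ + 1 - b = -(b - (σ + 1)) by ring, Real.rpow_neg ht0.le, Real.exp_neg]
            have := (Real.rpow_pos_of_pos ht0 (b - (σ + 1))).ne'
            field_simp
        _ ≤ _ := by gcongr
    have h3 : -(1 / 2) * t ^ s ≤ s * t ^ (s - 1) := by
      rw [Real.rpow_sub_one ht0.ne', mul_div_assoc', le_div_iff₀ ht0]
      have h4 := (abs_le.1 hsS).1
      have h5 : 2 * S ≤ t := (le_max_right _ _).trans ht
      have : 0 < t ^ s := Real.rpow_pos_of_pos ht0 s
      nlinarith
    calc ‖a‖ * t ^ (σ - 1) * ‖kummerM (a + 1) b t‖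
        ≤ R' * t ^ (σ - 1) * (Real.exp t * t ^ (σ + 1 - b) * (C * t ^ q)) := by gcongr
      _ = C * R' * (Real.exp t * t ^ s) := by
        rw [show s = (σ - 1) + (σ + 1 - b) + q by rw [hs]; ring, Real.rpow_add ht0,
          Real.rpow_add ht0]
        ring
      _ ≤ K * (1 / 2) * (Real.exp t * t ^ s) := by
        refine mul_le_mul_of_nonneg_right ?_ (by positivity)
        rw [hK]; linarith
      _ = K * (Real.exp t * t ^ s + Real.exp t * (-(1 / 2) * t ^ s)) := by ring
      _ ≤ _ := by gcongr

/-- The derivative at shift j is x^{-2} times the function at shift j+1, hence O(x^{q-1}), which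
integrates to O(x^q). All shifts are assumed because each one uses the next; q ≥ 1/2 keeps the
integration free of logarithms and its constant at most 2. -/
theorem KummerBound.of_add_one {b R q : ℝ} (hb : 0 < b) (hR : 0 ≤ R) (hq : 1 / 2 ≤ q)
    (h : ∀ j, KummerBound b R j (q + 1)) (j : ℕ) : KummerBound b R j q := by
  obtain ⟨C₀, X₀, hC₀, hX₀, h₀⟩ := h j
  obtain ⟨C, X, hC, hX, h⟩ := h (j + 1)
  set Y : ℝ := max X₀ X with hY
  have hY1 : 1 ≤ Y := hX.trans (le_max_right _ _)
  have hY0 : 0 < Y := by linarith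
  set D : ℝ := b + (R + j) with hD
  have hD0 : 0 ≤ D := by positivity
  refine ⟨2 * (D * C) + C₀ * Y, Y, by positivity, hY1, fun a₀ ha₀ x hx => ?_⟩
  have hpos : ∀ t, Y ≤ t → 0 < t := fun t ht => hY0.trans_le ht
  have hbd := norm_le_of_norm_deriv_le (u := kummerNormalized b (a₀ - j))
    (fun t ht => hasDerivAt_kummerNormalized hb (a₀ - j) (hpos t ht))
    (B := fun t => (2 * (D * C) + C₀ * Y) * t ^ q)
    (fun t ht => (Real.hasDerivAt_rpow_const (Or.inl (hpos t ht).ne')).const_mul _) ?_ ?_ hx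
  · exact hbd
  · refine (h₀ a₀ ha₀ Y (le_max_left _ _)).trans ?_
    rw [Real.rpow_add_one hY0.ne']
    have : 0 ≤ 2 * (D * C) * Y ^ q := by positivity
    linarith
  · intro t ht
    have ht0 := hpos t ht
    have h1 := h a₀ ha₀ t ((le_max_right _ _).trans ht)
    have h2 : ‖(b : ℂ) - (a₀ - j)‖ ≤ D := by
      calc ‖(b : ℂ) - (a₀ - j)‖ ≤ ‖(b : ℂ)‖ + (‖a₀‖ + ‖(j : ℂ)‖) :=
            (norm_sub_le _ _).trans (by gcongr; exact norm_sub_le _ _)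
        _ ≤ D := by
          rw [Complex.norm_natCast, Complex.norm_real, Real.norm_of_nonneg hb.le]; linarith
    rw [norm_mul, norm_div, norm_pow, Complex.norm_real, Real.norm_of_nonneg ht0.le,
      show a₀ - j - 1 = a₀ - (j + 1 : ℕ) by push_cast; ring]
    calc ‖(b : ℂ) - (a₀ - j)‖ / t ^ 2 * ‖kummerNormalized b (a₀ - (j + 1 : ℕ)) t‖
        ≤ D / t ^ 2 * (C * t ^ (q + 1)) := by gcongr
      _ = 2 * (D * C) * (1 / 2 * t ^ (q - 1)) := by
        rw [show q + 1 = (q - 1) + (2 : ℕ) by push_cast; ring, Real.rpow_add_natCast ht0.ne']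
        field_simp
      _ ≤ (2 * (D * C) + C₀ * Y) * (q * t ^ (q - 1)) := by
        gcongr
        have : 0 ≤ C₀ * Y := by positivity
        linarith

theorem kummerBound_half {b R : ℝ} (hb : 0 < b) (hR : 0 ≤ R) (j : ℕ) :
    KummerBound b R j (1 / 2) := by
  obtain ⟨q, hq, h⟩ := exists_kummerBound hb hR
  obtain ⟨N, hN⟩ := exists_nat_ge q
  have h1 : ∀ j, KummerBound b R j q := fun j => by
    induction j with
    | zero => exact h
    | succ j ih => exact ih.succ hb hR hq
  -- The exponent is first raised to the form 1/2 + N, so that descent by unit steps ends exactly at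
  -- 1/2.
  have h2 : ∀ n : ℕ, (∀ j, KummerBound b R j (1 / 2 + n)) → ∀ j, KummerBound b R j (1 / 2) := by
    intro n
    induction n with
    | zero => intro h j; simpa using h j
    | succ n ih =>
      intro h
      refine ih (KummerBound.of_add_one hb hR (by linarith [n.cast_nonneg (α := ℝ)]) fun j => ?_)
      convert h j using 1
      push_cast; ring
  refine h2 N (fun j => ?_) j
  obtain ⟨C, X, hC, hX, h⟩ := h1 j
  refine ⟨C, X, hC, hX, fun a ha x hx => (h a ha x hx).trans ?_⟩
  gcongr
  · exact hX.trans hx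
  · linarith

/-! ### Locally uniform convergence to an entire limit -/

/-- The limit of the normalised Kummer function. -/
noncomputable def kummerLimit (b : ℝ) (a : ℂ) : ℂ :=
  limUnder atTop (kummerNormalized b a)

/-- The bound x^{1/2} at shift 1 makes the x-derivative O(x^{-3/2}), which is integrable at infinity
and leaves a tail of order x^{-1/2}. -/
theorem exists_norm_kummerNormalized_sub_le {b R : ℝ} (hb : 0 < b) (hR : 0 ≤ R) :
    ∃ C X : ℝ, 0 ≤ C ∧ 1 ≤ X ∧ ∀ a : ℂ, ‖a‖ ≤ R → ∀ x : ℝ, X ≤ x → ∀ y : ℝ, x ≤ y →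
      ‖kummerNormalized b a y - kummerNormalized b a x‖ ≤ C * x ^ (-(1 / 2) : ℝ) := by
  obtain ⟨C, X, hC, hX, h⟩ := kummerBound_half hb hR 1
  refine ⟨2 * ((b + R) * C), X, by positivity, hX, fun a ha x hx y hy => ?_⟩
  have hx0 : 0 < x := by linarith
  have hpos : ∀ t, x ≤ t → 0 < t := fun t ht => hx0.trans_le ht
  have hbd := norm_le_of_norm_deriv_le
    (u := fun t => kummerNormalized b a t - kummerNormalized b a x)
    (fun t ht => (hasDerivAt_kummerNormalized hb a (hpos t ht)).sub_const _)
    (B := fun t => 2 * ((b + R) * C) * (x ^ (-(1 / 2) : ℝ) - t ^ (-(1 / 2) : ℝ)))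
    (fun t ht => ((Real.hasDerivAt_rpow_const (Or.inl (hpos t ht).ne')).const_sub _).const_mul _)
    (by simp) ?_ hy
  · refine hbd.trans ?_
    have : 0 ≤ y ^ (-(1 / 2) : ℝ) := Real.rpow_nonneg (hpos y hy).le _
    gcongr
    linarith
  · intro t ht
    have ht0 := hpos t ht
    have h1 := h a ha t (hx.trans ht)
    rw [Nat.cast_one] at h1
    have h2 : ‖(b : ℂ) - a‖ ≤ b + R := by
      refine (norm_sub_le _ _).trans ?_
      rw [Complex.norm_real, Real.norm_of_nonneg hb.le]; linarith
    rw [norm_mul, norm_div, norm_pow, Complex.norm_real, Real.norm_of_nonneg ht0.le]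
    calc ‖(b : ℂ) - a‖ / t ^ 2 * ‖kummerNormalized b (a - 1) t‖
        ≤ (b + R) / t ^ 2 * (C * t ^ (1 / 2 : ℝ)) := by gcongr
      _ = _ := by
        rw [show (1 / 2 : ℝ) = (-(1 / 2) - 1) + (2 : ℕ) by norm_num, Real.rpow_add_natCast ht0.ne']
        norm_num
        field_simp

theorem tendsto_kummerNormalized {b : ℝ} (hb : 0 < b) (a : ℂ) :
    Tendsto (kummerNormalized b a) atTop (nhds (kummerLimit b a)) := by
  obtain ⟨C, X, hC, hX, h⟩ := exists_norm_kummerNormalized_sub_le hb (norm_nonneg a)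
  have hlim : Tendsto (fun x : ℝ => C * x ^ (-(1 / 2) : ℝ)) atTop (nhds 0) := by
    simpa using (tendsto_rpow_neg_atTop (by norm_num : (0 : ℝ) < 1 / 2)).const_mul C
  refine tendsto_nhds_limUnder (cauchy_map_iff_exists_tendsto.1 ?_)
  refine Metric.cauchy_iff.2 ⟨inferInstance, fun ε hε => ?_⟩
  obtain ⟨x, hx1, hx2⟩ := ((hlim.eventually (gt_mem_nhds (half_pos hε))).and
    (eventually_ge_atTop X)).exists
  refine ⟨kummerNormalized b a '' Set.Ici x, image_mem_map (Ici_mem_atTop x), ?_⟩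
  rintro _ ⟨y, hy, rfl⟩ _ ⟨z, hz, rfl⟩
  rw [dist_eq_norm]
  have h1 := h a le_rfl x hx2 y hy
  have h2 := h a le_rfl x hx2 z hz
  calc ‖kummerNormalized b a y - kummerNormalized b a z‖
      = ‖(kummerNormalized b a y - kummerNormalized b a x)
        - (kummerNormalized b a z - kummerNormalized b a x)‖ := by congr 1; ring
    _ ≤ _ := norm_sub_le _ _
    _ < ε := by linarith

theorem tendstoLocallyUniformlyOn_kummerNormalized {b : ℝ} (hb : 0 < b) :
    TendstoLocallyUniformlyOn (fun (x : ℝ) (a : ℂ) => kummerNormalized b a x) (kummerLimit b)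
      atTop Set.univ := by
  rw [tendstoLocallyUniformlyOn_iff_forall_isCompact isOpen_univ]
  intro K _ hK
  obtain ⟨R, hR⟩ := hK.isBounded.exists_norm_le
  obtain ⟨C, X, hC, hX, h⟩ := exists_norm_kummerNormalized_sub_le hb (le_max_right R 0)
  have hlim : Tendsto (fun x : ℝ => C * x ^ (-(1 / 2) : ℝ)) atTop (nhds 0) := by
    simpa using (tendsto_rpow_neg_atTop (by norm_num : (0 : ℝ) < 1 / 2)).const_mul C
  rw [Metric.tendstoUniformlyOn_iff]
  intro ε hε
  filter_upwards [hlim.eventually (gt_mem_nhds hε), eventually_ge_atTop X] with x hx1 hx2 a ha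
  rw [dist_eq_norm]
  refine lt_of_le_of_lt ?_ hx1
  refine le_of_tendsto ((tendsto_kummerNormalized hb a).sub_const _).norm ?_
  filter_upwards [eventually_ge_atTop x] with y hy
  exact h a ((hR a ha).trans (le_max_left _ _)) x hx2 y hy

theorem differentiable_kummerNormalized {b : ℝ} (hb : 0 < b) {x : ℝ} (hx : 0 < x) :
    Differentiable ℂ fun a => kummerNormalized b a x := by
  unfold kummerNormalized
  have h1 := differentiable_kummerM_fst hb x
  have hx0 : (x : ℂ) ≠ 0 := by exact_mod_cast hx.ne'
  refine (Differentiable.mul (differentiable_const _) fun a => ?_).mul h1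
  exact ((differentiableAt_const _).sub differentiableAt_id).const_cpow (Or.inl hx0)

theorem differentiable_kummerLimit {b : ℝ} (hb : 0 < b) : Differentiable ℂ (kummerLimit b) := by
  rw [← differentiableOn_univ]
  refine (tendstoLocallyUniformlyOn_kummerNormalized hb).differentiableOn ?_ isOpen_univ
  filter_upwards [eventually_gt_atTop 0] with x hx
  exact (differentiable_kummerNormalized hb hx).differentiableOn

theorem tendstoLocallyUniformlyOn_deriv_kummerNormalized {b : ℝ} (hb : 0 < b) :
    TendstoLocallyUniformlyOn (fun (x : ℝ) => deriv fun a : ℂ => kummerNormalized b a x)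
      (deriv (kummerLimit b)) atTop Set.univ := by
  refine (tendstoLocallyUniformlyOn_kummerNormalized hb).deriv ?_ isOpen_univ
  filter_upwards [eventually_gt_atTop 0] with x hx
  exact (differentiable_kummerNormalized hb hx).differentiableOn

/-! ### The functional equation of the limit and its value at 1 -/

theorem kummerNormalized_contiguous {b : ℝ} (hb : 0 < b) (a : ℂ) {x : ℝ} (hx : 0 < x) :
    (b - a) / x ^ 2 * kummerNormalized b (a - 1) x + ((2 * a - b) / x + 1) * kummerNormalized b a x
      = a * kummerNormalized b (a + 1) x := by
  have hx0 : (x : ℂ) ≠ 0 := by exact_mod_cast hx.ne'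
  have h := kummerM_contiguous hb a x
  simp only [kummerNormalized]
  rw [show (b : ℂ) - (a - 1) = b - a + 1 by ring, show (b : ℂ) - (a + 1) = b - a - 1 by ring,
    Complex.cpow_add _ _ hx0, Complex.cpow_sub ((b : ℂ) - a) 1 hx0, Complex.cpow_one]
  generalize (x : ℂ) ^ ((b : ℂ) - a) = P
  field_simp
  linear_combination P * h

theorem tendsto_ofReal_inv_atTop : Tendsto (fun x : ℝ => (x : ℂ)⁻¹) atTop (nhds 0) := by
  have := (Complex.continuous_ofReal.tendsto 0).comp tendsto_inv_atTop_zero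
  simpa [Function.comp_def] using this

/-- The limit of the contiguous relation: the coefficients carrying 1/x and 1/x² disappear. -/
theorem kummerLimit_eq_mul {b : ℝ} (hb : 0 < b) (a : ℂ) :
    kummerLimit b a = a * kummerLimit b (a + 1) := by
  have h1 := (tendsto_kummerNormalized hb (a + 1)).const_mul a
  have h2 := ((tendsto_ofReal_inv_atTop.pow 2).const_mul (b - a)).mul
    (tendsto_kummerNormalized hb (a - 1))
  have h3 := ((tendsto_ofReal_inv_atTop.const_mul (2 * a - b)).add_const 1).mul
    (tendsto_kummerNormalized hb a)
  have h4 := h2.add h3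
  simp only [ne_eq, OfNat.ofNat_ne_zero, not_false_eq_true, zero_pow, mul_zero, zero_mul, zero_add,
    one_mul] at h4
  refine tendsto_nhds_unique h4 (h1.congr' ?_)
  filter_upwards [eventually_gt_atTop 0] with x hx
  rw [← kummerNormalized_contiguous hb a hx]
  ring

theorem kummerNormalized_zero (b x : ℝ) :
    kummerNormalized b 0 x = Complex.exp (-x) * (x : ℂ) ^ (b : ℂ) := by
  simp [kummerNormalized, kummerM_zero_fst]

/-- Since M(0) = 1, the derivative at a = 1 is an explicit Gamma integrand. Using b+1 instead of b
makes the function x^b e^{-x} M(1,b+1,x) continuous with value 0 at x = 0. -/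
theorem kummerNormalized_one_succ {b x : ℝ} (hb : 0 < b) (hx : 0 < x) :
    kummerNormalized (b + 1) 1 x = ((b * ∫ t in (0)..x, Real.exp (-t) * t ^ (b - 1) : ℝ) : ℂ) := by
  have hb1 : 0 < b + 1 := by linarith
  have hF : (fun t : ℝ => kummerNormalized (b + 1) 1 t)
      = fun t : ℝ => Complex.exp (-t) * (t : ℂ) ^ (b : ℂ) * kummerM 1 ((b + 1 : ℝ) : ℂ) t := by
    funext t
    rw [kummerNormalized]
    congr 3
    push_cast; ring
  have hcont : Continuous fun t : ℝ => kummerNormalized (b + 1) 1 t := by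
    rw [hF]
    have h1 := Complex.continuous_ofReal_cpow_const (y := (b : ℂ)) (by simpa using hb)
    have h2 := (differentiable_kummerM hb1 1).continuous.comp Complex.continuous_ofReal
    exact ((by fun_prop : Continuous fun t : ℝ => Complex.exp (-t)).mul h1).mul h2
  have hint : IntervalIntegrable (fun t : ℝ => Real.exp (-t) * t ^ (b - 1)) MeasureTheory.volume 0 x :=
    (intervalIntegral.intervalIntegrable_rpow' (by linarith)).continuousOn_mul (by fun_prop)
  have h := intervalIntegral.integral_eq_sub_of_hasDerivAt_of_le hx.le hcont.continuousOn
    (f' := fun t : ℝ => ((b * (Real.exp (-t) * t ^ (b - 1)) : ℝ) : ℂ)) (fun t ht => by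
      refine (hasDerivAt_kummerNormalized hb1 1 ht.1).congr_deriv ?_
      have ht0 : (t : ℂ) ≠ 0 := by exact_mod_cast ht.1.ne'
      rw [sub_self, kummerNormalized_zero, show ((b + 1 : ℝ) : ℂ) = b - 1 + (2 : ℕ) by push_cast; ring,
        Complex.cpow_add _ _ ht0, Complex.cpow_natCast]
      push_cast [Complex.ofReal_cpow ht.1.le]
      field_simp
      ring) ⟨(hint.const_mul b).1.ofReal, (hint.const_mul b).2.ofReal⟩
  rw [intervalIntegral.integral_ofReal, intervalIntegral.integral_const_mul] at h
  have h0 : kummerNormalized (b + 1) 1 0 = 0 := by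
    have := congrFun hF 0
    rw [this]
    simp [hb.ne']
  rw [h, h0, sub_zero]

theorem kummerLimit_one_succ {b : ℝ} (hb : 0 < b) :
    kummerLimit (b + 1) 1 = b * Real.Gamma b := by
  refine tendsto_nhds_unique (tendsto_kummerNormalized (by linarith) 1) ?_
  have h1 := MeasureTheory.intervalIntegral_tendsto_integral_Ioi 0
    (Real.GammaIntegral_convergent hb) tendsto_id
  rw [← Real.Gamma_eq_integral hb] at h1
  have h2 := (Complex.continuous_ofReal.tendsto _).comp (h1.const_mul b)
  push_cast at h2
  refine h2.congr' ?_
  filter_upwards [eventually_gt_atTop 0] with x hx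
  rw [kummerNormalized_one_succ hb hx]
  rfl

/-- From M(1,b,x) = 1 + (x/b) M(1,b+1,x), the normalised functions for b and b+1 differ by the
factor 1/b and the vanishing term e^{-x} x^{b-1}. -/
theorem kummerLimit_one {b : ℝ} (hb : 0 < b) : kummerLimit b 1 = Real.Gamma b := by
  have hb0 : (b : ℂ) ≠ 0 := by exact_mod_cast hb.ne'
  have h1 := (tendsto_kummerNormalized (by linarith : 0 < b + 1) 1).const_mul (b : ℂ)⁻¹
  have h2 : Tendsto (fun x : ℝ => Complex.exp (-x) * (x : ℂ) ^ ((b : ℂ) - 1)) atTop (nhds 0) := by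
    have := tendsto_rpow_mul_exp_neg_mul_atTop_nhds_zero (b - 1) 1 one_pos
    have := (Complex.continuous_ofReal.tendsto _).comp this
    rw [Complex.ofReal_zero] at this
    refine this.congr' ?_
    filter_upwards [eventually_gt_atTop 0] with x hx
    simp only [Function.comp]
    push_cast [Complex.ofReal_cpow hx.le]
    rw [neg_one_mul, mul_comm]
  have h3 := h2.add h1
  rw [kummerLimit_one_succ hb, zero_add, inv_mul_cancel_left₀ hb0] at h3
  refine tendsto_nhds_unique (tendsto_kummerNormalized hb 1) (h3.congr' ?_)
  filter_upwards [eventually_gt_atTop 0] with x hx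
  have hx0 : (x : ℂ) ≠ 0 := by exact_mod_cast hx.ne'
  rw [kummerNormalized, kummerNormalized, kummerM_one_eq hb, show ((b + 1 : ℝ) : ℂ) - 1 = b - 1 + 1 by
    push_cast; ring, Complex.cpow_add _ _ hx0, Complex.cpow_one]
  push_cast
  field_simp

/-! ### Real zeros of the limit and the derivatives there -/

/-- The normalised Kummer function of real arguments. -/
noncomputable def kummerNormalizedReal (b a x : ℝ) : ℝ :=
  Real.exp (-x) * x ^ (b - a) * kummerReal a b x

theorem kummerNormalized_ofReal (b a : ℝ) {x : ℝ} (hx : 0 ≤ x) :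
    kummerNormalized b a x = kummerNormalizedReal b a x := by
  rw [kummerNormalized, kummerNormalizedReal, kummerM_ofReal]
  push_cast [Complex.ofReal_cpow hx]
  rfl

theorem hasDerivAt_kummerNormalizedReal {b : ℝ} (hb : 0 < b) (a : ℝ) {x : ℝ} (hx : 0 < x) :
    HasDerivAt (kummerNormalizedReal b a) ((b - a) / x ^ 2 * kummerNormalizedReal b (a - 1) x) x := by
  have h1 := Complex.reCLM.hasFDerivAt.comp_hasDerivAt x (hasDerivAt_kummerNormalized hb a hx)
  have e : (b - (a : ℂ)) / x ^ 2 * kummerNormalized b (a - 1) x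
      = (((b - a) / x ^ 2 * kummerNormalizedReal b (a - 1) x : ℝ) : ℂ) := by
    push_cast [← kummerNormalized_ofReal b (a - 1) hx.le]
    rfl
  rw [e, Complex.reCLM_apply, Complex.ofReal_re] at h1
  refine h1.congr_of_eventuallyEq ?_
  filter_upwards [lt_mem_nhds hx] with y hy
  simp [kummerNormalized_ofReal b a hy.le]

/-- The contiguous relation at t-1 is solved for x M(t-1). For t ≥ 2 all parameters involved are
nonnegative, so monotonicity bounds the rest by M(t). -/
theorem mul_kummerReal_sub_one_le {b t x : ℝ} (hb : 0 < b) (ht : 2 ≤ t) (hx : 0 ≤ x) :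
    x * kummerReal (t - 1) b x ≤ (t - 1 + |b + 2 - 2 * t| + |b - t + 1|) * kummerReal t b x := by
  have h := kummerReal_contiguous hb (t - 1) x
  rw [sub_add_cancel] at h
  have h1 : kummerReal (t - 1) b x ≤ kummerReal t b x :=
    kummerReal_mono hb hx (by linarith) (by linarith)
  have h2 : kummerReal (t - 1 - 1) b x ≤ kummerReal t b x :=
    kummerReal_mono hb hx (by linarith) (by linarith)
  have h3 := one_le_kummerReal (a := t - 1) hb hx (by linarith)
  have h4 := one_le_kummerReal (a := t - 1 - 1) hb hx (by linarith)
  have h5 : (b + 2 - 2 * t) * kummerReal (t - 1) b x ≤ |b + 2 - 2 * t| * kummerReal t b x :=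
    mul_le_mul (le_abs_self _) h1 (by linarith) (abs_nonneg _)
  have h6 : -(b - t + 1) * kummerReal (t - 1 - 1) b x ≤ |b - t + 1| * kummerReal t b x :=
    mul_le_mul (neg_le_abs _) h2 (by linarith) (abs_nonneg _)
  linarith

/-- Here the x-derivative of f is at least -K x^{-2} f, so f e^{-K/x} is nondecreasing and positive,
and f stays bounded away from 0. -/
theorem kummerLimit_ne_zero_of_two_le {b t : ℝ} (hb : 0 < b) (ht : 2 ≤ t) :
    kummerLimit b t ≠ 0 := by
  set K' : ℝ := t - 1 + |b + 2 - 2 * t| + |b - t + 1|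
  have hpos : ∀ x : ℝ, 0 < x → 0 < kummerNormalizedReal b t x := fun x hx => by
    have := one_le_kummerReal (a := t) hb hx.le (by linarith)
    have := Real.rpow_pos_of_pos hx (b - t)
    unfold kummerNormalizedReal
    positivity
  have hK' : 0 ≤ K' := by
    have : 0 ≤ t - 1 := by linarith
    positivity
  set K : ℝ := |b - t| * K'
  have hK : 0 ≤ K := by positivity
  have hle : ∀ x : ℝ, 0 < x → -(K * kummerNormalizedReal b t x)
      ≤ (b - t) * kummerNormalizedReal b (t - 1) x := by
    intro x hx
    have h1 : kummerNormalizedReal b (t - 1) x ≤ K' * kummerNormalizedReal b t x := by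
      rw [kummerNormalizedReal, kummerNormalizedReal, show b - (t - 1) = b - t + 1 by ring,
        Real.rpow_add_one hx.ne']
      calc Real.exp (-x) * (x ^ (b - t) * x) * kummerReal (t - 1) b x
          = Real.exp (-x) * x ^ (b - t) * (x * kummerReal (t - 1) b x) := by ring
        _ ≤ Real.exp (-x) * x ^ (b - t) * (K' * kummerReal t b x) :=
          mul_le_mul_of_nonneg_left (mul_kummerReal_sub_one_le hb ht hx.le) (by positivity)
        _ = _ := by ring
    have h0 : 0 ≤ kummerNormalizedReal b (t - 1) x := by
      have := one_le_kummerReal (a := t - 1) hb hx.le (by linarith)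
      unfold kummerNormalizedReal
      positivity
    calc -(K * kummerNormalizedReal b t x) = -(|b - t| * (K' * kummerNormalizedReal b t x)) := by
          simp only [K]; ring
      _ ≤ -(|b - t| * kummerNormalizedReal b (t - 1) x) := by gcongr
      _ = -|b - t| * kummerNormalizedReal b (t - 1) x := by ring
      _ ≤ _ := by gcongr; exact neg_abs_le _
  set ψ : ℝ → ℝ := fun x => kummerNormalizedReal b t x * Real.exp (-K * x⁻¹) with hψ
  have hd : ∀ x : ℝ, 0 < x → HasDerivAt ψ (Real.exp (-K * x⁻¹) / x ^ 2 *
      ((b - t) * kummerNormalizedReal b (t - 1) x + K * kummerNormalizedReal b t x)) x := by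
    intro x hx
    refine ((hasDerivAt_kummerNormalizedReal hb t hx).mul
      (((hasDerivAt_inv hx.ne').const_mul (-K)).exp)).congr_deriv ?_
    ring
  have hmono : MonotoneOn ψ (Set.Ici 1) := by
    refine monotoneOn_of_deriv_nonneg (convex_Ici 1) (fun x hx => ?_) (fun x hx => ?_) fun x hx => ?_
    · exact (hd x (one_pos.trans_le hx)).continuousAt.continuousWithinAt
    · rw [interior_Ici] at hx
      exact (hd x (one_pos.trans hx)).differentiableAt.differentiableWithinAt
    · rw [interior_Ici] at hx
      rw [(hd x (one_pos.trans hx)).deriv]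
      refine mul_nonneg (by positivity) ?_
      linarith [hle x (one_pos.trans hx)]
  have hc : 0 < ψ 1 := mul_pos (hpos 1 one_pos) (Real.exp_pos _)
  have hlim : ψ 1 ≤ ‖kummerLimit b t‖ := by
    refine ge_of_tendsto (tendsto_kummerNormalized hb t).norm ?_
    filter_upwards [eventually_ge_atTop 1] with x hx
    have hx0 : 0 < x := by linarith
    rw [kummerNormalized_ofReal b t hx0.le, Complex.norm_real, Real.norm_of_nonneg (hpos x hx0).le]
    refine (hmono (Set.mem_Ici.2 le_rfl) hx hx).trans ?_
    refine mul_le_of_le_one_right (hpos x hx0).le (Real.exp_le_one_iff.2 ?_)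
    have : 0 ≤ K * x⁻¹ := by positivity
    linarith
  exact norm_pos_iff.1 (hc.trans_le hlim)

theorem kummerLimit_neg_nat {b : ℝ} (hb : 0 < b) (k : ℕ) : kummerLimit b (-(k : ℂ)) = 0 := by
  induction k with
  | zero => rw [kummerLimit_eq_mul hb]; simp
  | succ k ih =>
    rw [kummerLimit_eq_mul hb]
    push_cast
    rw [neg_add, neg_add_cancel_right, ih, mul_zero]

theorem kummerLimit_ne_zero {b t : ℝ} (hb : 0 < b) (ht : ∀ n : ℕ, t ≠ -n) :
    kummerLimit b t ≠ 0 := by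
  have key : ∀ n : ℕ, ∀ t : ℝ, 2 ≤ t + n → (∀ m : ℕ, t ≠ -m) → kummerLimit b t ≠ 0 := by
    intro n
    induction n with
    | zero => intro t h2 _; exact kummerLimit_ne_zero_of_two_le hb (by simpa using h2)
    | succ n ih =>
      intro t h2 ht
      rw [kummerLimit_eq_mul hb]
      refine mul_ne_zero (by simpa using ht 0) ?_
      have := ih (t + 1) (by push_cast at h2; linarith) fun m hm => ht (m + 1) (by
        push_cast; linarith)
      simpa using this
  obtain ⟨n, hn⟩ := exists_nat_ge (2 - t)
  exact key n t (by linarith) ht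

/-- Differentiating g(a) = a g(a+1) gives g'(a) = g(a+1) + a g'(a+1). At 0 this is g(1) = Γ(b); at
-(k+1) the first term vanishes. -/
theorem deriv_kummerLimit_neg_nat {b : ℝ} (hb : 0 < b) (k : ℕ) :
    deriv (kummerLimit b) (-(k : ℂ)) = (-1) ^ k * k.factorial * Real.Gamma b := by
  have hd : ∀ a : ℂ, deriv (kummerLimit b) a
      = kummerLimit b (a + 1) + a * deriv (kummerLimit b) (a + 1) := by
    intro a
    have h1 : HasDerivAt (fun a => a * kummerLimit b (a + 1))
        (1 * kummerLimit b (a + 1) + a * deriv (kummerLimit b) (a + 1)) a :=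
      (hasDerivAt_id a).mul
        ((differentiable_kummerLimit hb (a + 1)).hasDerivAt.comp_add_const a 1)
    have h2 : (fun a => a * kummerLimit b (a + 1)) = kummerLimit b :=
      funext fun a => (kummerLimit_eq_mul hb a).symm
    rw [h2, one_mul] at h1
    exact h1.deriv
  induction k with
  | zero => rw [hd]; simp [kummerLimit_one hb]
  | succ k ih =>
    rw [hd]
    push_cast
    rw [neg_add, neg_add_cancel_right, ih, kummerLimit_neg_nat hb, Nat.factorial_succ, pow_succ]
    push_cast
    ring

theorem deriv_kummerLimit_neg_nat_ne_zero {b : ℝ} (hb : 0 < b) (k : ℕ) :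
    deriv (kummerLimit b) (-(k : ℂ)) ≠ 0 := by
  rw [deriv_kummerLimit_neg_nat hb]
  have h1 : (k.factorial : ℂ) ≠ 0 := by exact_mod_cast k.factorial_ne_zero
  have h2 : (Real.Gamma b : ℂ) ≠ 0 := by exact_mod_cast (Real.Gamma_pos_of_pos hb).ne'
  have h3 : (-1 : ℂ) ^ k ≠ 0 := pow_ne_zero _ (by norm_num)
  exact mul_ne_zero (mul_ne_zero h3 h1) h2

/-! ### Localisation of the zeros: s_k → k -/

theorem kummerNormalized_eq_zero_iff (b : ℝ) (a : ℂ) {x : ℝ} (hx : 0 < x) :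
    kummerNormalized b a x = 0 ↔ kummerM a b x = 0 := by
  have hx0 : (x : ℂ) ≠ 0 := by exact_mod_cast hx.ne'
  simp [kummerNormalized, Complex.cpow_eq_zero_iff, hx0]

/-- Near `-k` the normalised function is uniformly close to its linearisation. -/
theorem kummerNormalized_strict_deriv {b : ℝ} (hb : 0 < b) (k : ℕ) {ε : ℝ} (hε : 0 < ε) :
    ∃ r > 0, ∀ᶠ x : ℝ in atTop,
      (∀ u ∈ Metric.ball (-(k : ℂ)) r,
        ‖deriv (fun a => kummerNormalized b a x) u - deriv (kummerLimit b) (-(k : ℂ))‖ ≤ ε) ∧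
      ∀ u ∈ Metric.ball (-(k : ℂ)) r, ∀ v ∈ Metric.ball (-(k : ℂ)) r,
        ‖kummerNormalized b u x - kummerNormalized b v x
          - deriv (kummerLimit b) (-(k : ℂ)) * (u - v)‖ ≤ ε * ‖u - v‖ := by
  set c := deriv (kummerLimit b) (-(k : ℂ)) with hc
  have hcont : ContinuousAt (deriv (kummerLimit b)) (-(k : ℂ)) :=
    ((differentiable_kummerLimit hb).contDiff (n := 1)).continuous_deriv le_rfl |>.continuousAt
  obtain ⟨r, hr, hball⟩ := Metric.continuousAt_iff.1 hcont (ε / 2) (half_pos hε)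
  have hunif := (tendstoLocallyUniformlyOn_iff_forall_isCompact isOpen_univ).1
    (tendstoLocallyUniformlyOn_deriv_kummerNormalized hb) _ (Set.subset_univ _)
    (isCompact_closedBall (-(k : ℂ)) r)
  rw [Metric.tendstoUniformlyOn_iff] at hunif
  refine ⟨r, hr, ?_⟩
  filter_upwards [hunif (ε / 2) (half_pos hε), eventually_gt_atTop 0] with x hx hx0
  have h1 : ∀ u ∈ Metric.ball (-(k : ℂ)) r,
      ‖deriv (fun a => kummerNormalized b a x) u - c‖ ≤ ε := by
    intro u hu
    have h2 := hball hu
    have h3 := hx u (Metric.ball_subset_closedBall hu)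
    rw [← dist_eq_norm]
    rw [dist_comm] at h3
    linarith [dist_triangle (deriv (fun a => kummerNormalized b a x) u)
      (deriv (kummerLimit b) u) c]
  refine ⟨h1, fun u hu v hv => ?_⟩
  have hd : ∀ w : ℂ, HasDerivAt (fun a => kummerNormalized b a x - c * a)
      (deriv (fun a => kummerNormalized b a x) w - c) w := fun w =>
    ((differentiable_kummerNormalized hb hx0 w).hasDerivAt.sub
      ((hasDerivAt_id w).const_mul c)).congr_deriv (by simp)
  have h4 := (convex_ball (-(k : ℂ)) r).norm_image_sub_le_of_norm_hasDerivWithin_le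
    (fun w _ => (hd w).hasDerivWithinAt) h1 hv hu
  refine le_trans (le_of_eq (congrArg norm ?_)) h4
  ring

/-- After division by g'(-k), the function differs from the identity by a map with Lipschitz
constant 1/2 near -k: existence follows from a sign change at -k ± δ, uniqueness from |u-t| ≤
|u-t|/2. Quantifying over all small δ lets finitely many k share one δ. -/
theorem eventually_existsUnique_zero {b : ℝ} (hb : 0 < b) (k : ℕ) :
    ∀ᶠ δ : ℝ in nhdsWithin 0 (Set.Ioi 0), ∀ᶠ x : ℝ in atTop,
      ∃! t : ℝ, |t + k| < δ ∧ kummerM t b x = 0 := by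
  set d : ℝ := (-1) ^ k * k.factorial * Real.Gamma b with hd
  have hcd : deriv (kummerLimit b) (-(k : ℂ)) = d := by
    rw [deriv_kummerLimit_neg_nat hb]; push_cast [hd]; rfl
  have hd0 : d ≠ 0 := by
    have := deriv_kummerLimit_neg_nat_ne_zero hb k
    rw [hcd] at this
    exact_mod_cast this
  obtain ⟨r, hr, h⟩ := kummerNormalized_strict_deriv hb k (half_pos (abs_pos.2 hd0))
  filter_upwards [Ioo_mem_nhdsGT hr] with δ hδ
  have hδ0 := hδ.1
  have hlim := tendsto_kummerNormalized hb (-(k : ℂ))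
  rw [kummerLimit_neg_nat hb] at hlim
  have hsmall := (hlim.norm.eventually (gt_mem_nhds (by
    rw [norm_zero]; positivity : ‖(0 : ℂ)‖ < |d| * δ / 4)))
  filter_upwards [h, hsmall, eventually_gt_atTop 0] with x hx hxs hx0
  replace hx := hx.2
  rw [hcd] at hx
  have hball : ∀ t : ℝ, |t + k| ≤ δ → (t : ℂ) ∈ Metric.ball (-(k : ℂ)) r := by
    intro t ht
    rw [mem_ball_iff_norm, sub_neg_eq_add]
    have : (t : ℂ) + k = ((t + k : ℝ) : ℂ) := by push_cast; rfl
    rw [this, Complex.norm_real]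
    exact lt_of_le_of_lt ht hδ.2
  have hreal : ∀ u v : ℝ, |u + k| ≤ δ → |v + k| ≤ δ →
      |kummerNormalizedReal b u x - kummerNormalizedReal b v x - d * (u - v)|
        ≤ |d| / 2 * |u - v| := by
    intro u v hu hv
    have := hx u (hball u hu) v (hball v hv)
    rw [kummerNormalized_ofReal b u hx0.le, kummerNormalized_ofReal b v hx0.le] at this
    rw [← Real.norm_eq_abs, ← Real.norm_eq_abs (u - v), ← Complex.norm_real, ← Complex.norm_real]
    push_cast
    exact this
  have hzero : ∀ t : ℝ, kummerM t b x = 0 ↔ kummerNormalizedReal b t x = 0 := by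
    intro t
    rw [← kummerNormalized_eq_zero_iff b t hx0, kummerNormalized_ofReal b t hx0.le]
    exact Complex.ofReal_eq_zero
  set G : ℝ → ℝ := fun t => kummerNormalizedReal b t x / d with hG
  have hG1 : ∀ u v : ℝ, |u + k| ≤ δ → |v + k| ≤ δ → |G u - G v - (u - v)| ≤ 1 / 2 * |u - v| := by
    intro u v hu hv
    have h1 := hreal u v hu hv
    have h2 : G u - G v - (u - v)
        = (kummerNormalizedReal b u x - kummerNormalizedReal b v x - d * (u - v)) / d := by
      simp only [hG]; field_simp
    rw [h2, abs_div, div_le_iff₀ (abs_pos.2 hd0)]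
    linarith
  have hGk : |G (-k)| < δ / 4 := by
    have : kummerNormalized b (-(k : ℂ)) x = kummerNormalizedReal b (-k : ℝ) x := by
      rw [← kummerNormalized_ofReal b _ hx0.le]; push_cast; rfl
    rw [this, Complex.norm_real, Real.norm_eq_abs] at hxs
    rw [hG, abs_div, div_lt_iff₀ (abs_pos.2 hd0)]
    linarith
  have hGc : Continuous G := by
    have h1 : Continuous fun t : ℝ => (kummerNormalized b t x).re :=
      Complex.continuous_re.comp
        ((differentiable_kummerNormalized hb hx0).continuous.comp Complex.continuous_ofReal)
    have h2 : (fun t : ℝ => (kummerNormalized b t x).re) = fun t => kummerNormalizedReal b t x := by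
      funext t; rw [kummerNormalized_ofReal b t hx0.le, Complex.ofReal_re]
    rw [h2] at h1
    exact h1.div_const d
  have hk0 : |(-k : ℝ) + k| ≤ δ := by simpa using hδ0.le
  have hkm : |(-k - δ : ℝ) + k| ≤ δ := by
    rw [show (-k - δ : ℝ) + k = -δ by ring, abs_neg, abs_of_pos hδ0]
  have hpos : 0 < G (-k + δ) := by
    have := abs_le.1 (hG1 (-k + δ) (-k) (by simp [abs_of_pos hδ0]) hk0)
    have h2 := abs_lt.1 hGk
    rw [add_sub_cancel_left, abs_of_pos hδ0] at this
    linarith [this.1]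
  have hneg : G (-k - δ) < 0 := by
    have := abs_le.1 (hG1 (-k - δ) (-k) hkm hk0)
    have h2 := abs_lt.1 hGk
    rw [sub_sub_cancel_left, abs_neg, abs_of_pos hδ0] at this
    linarith [this.2]
  obtain ⟨t, ht, htz⟩ := intermediate_value_Ioo (by linarith : -(k : ℝ) - δ ≤ -k + δ)
    hGc.continuousOn ⟨hneg, hpos⟩
  have htk : |t + k| < δ := abs_lt.2 ⟨by linarith [ht.1], by linarith [ht.2]⟩
  refine ⟨t, ⟨htk, (hzero t).2 ?_⟩, fun u hu => ?_⟩
  · rcases div_eq_zero_iff.1 htz with h | h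
    · exact h
    · exact absurd h hd0
  · have hGu : G u = 0 := by simp [hG, (hzero u).1 hu.2]
    have h1 := hG1 u t hu.1.le htk.le
    rw [hGu, htz, sub_zero, zero_sub, abs_neg] at h1
    have h2 : |u - t| ≤ 0 := by linarith
    linarith [abs_nonpos_iff.1 h2]

/-- On the compact set of points of [A,0] at distance at least δ from every -n, |g| has a positive
lower bound, which uniform convergence transfers to f. Positive t needs no argument, since all zeros
are negative. -/
theorem eventually_ne_zero_of_far {b : ℝ} (hb : 0 < b) (A : ℝ) {δ : ℝ} (hδ : 0 < δ) :
    ∀ᶠ x : ℝ in atTop, ∀ t : ℝ, A ≤ t → (∀ n : ℕ, δ ≤ |t + n|) → kummerM t b x ≠ 0 := by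
  set K : Set ℝ := Set.Icc A 0 ∩ ⋂ n : ℕ, {t : ℝ | δ ≤ |t + n|} with hK
  have hKc : IsCompact K := isCompact_Icc.inter_right
    (isClosed_iInter fun n => isClosed_le continuous_const (by fun_prop))
  have hgc : Continuous fun t : ℝ => ‖kummerLimit b t‖ :=
    ((differentiable_kummerLimit hb).continuous.comp Complex.continuous_ofReal).norm
  have hg : ∀ t ∈ K, 0 < ‖kummerLimit b t‖ := by
    intro t ht
    refine norm_pos_iff.2 (kummerLimit_ne_zero hb fun n hn => ?_)
    have := Set.mem_iInter.1 ht.2 n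
    simp only [Set.mem_ofPred_eq, hn, neg_add_cancel, abs_zero] at this
    linarith
  obtain ⟨m, hm, hmK⟩ := hKc.exists_forall_le' hgc.continuousOn hg
  have hunif := (tendstoLocallyUniformlyOn_iff_forall_isCompact isOpen_univ).1
    (tendstoLocallyUniformlyOn_kummerNormalized hb) _ (Set.subset_univ _)
    (hKc.image Complex.continuous_ofReal)
  rw [Metric.tendstoUniformlyOn_iff] at hunif
  filter_upwards [hunif m hm, eventually_gt_atTop 0] with x hx hx0 t ht hfar h0
  have ht0 := (kummerM_eq_zero hb hx0 h0).2
  have htK : t ∈ K := ⟨⟨ht, le_of_lt (by simpa using ht0)⟩, Set.mem_iInter.2 hfar⟩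
  have h1 := hx t (Set.mem_image_of_mem _ htK)
  rw [(kummerNormalized_eq_zero_iff b t hx0).2 h0, dist_zero_right] at h1
  linarith [hmK t htK]

theorem kummerZero_eq {b x : ℝ} (hb : 0 < b) (hx : 0 < x) {k : ℕ} {z : ℕ → ℝ}
    (hz : ∀ i j, i < j → j ≤ k → z j < z i) (hz0 : ∀ j ≤ k, kummerM (z j) b x = 0)
    (hall : ∀ t : ℝ, z k ≤ t → kummerM t b x = 0 → ∃ j ≤ k, t = z j) :
    kummerZero b k x = -z k := by
  have hset : {r : ℝ | ((k + 1 : ℕ) : ℕ∞) ≤ (kummerZeros b x ∩ {a : ℂ | -r ≤ a.re}).encard}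
      = Set.Ici (-z k) := by
    ext r
    rw [Set.mem_ofPred_eq, Set.mem_Ici]
    constructor
    · intro h
      by_contra! hr
      -- When -r > z_k, only z_0, …, z_{k-1} can lie in the half-plane, which is too few.
      have hsub : kummerZeros b x ∩ {a : ℂ | -r ≤ a.re}
          ⊆ ((Finset.range k).image fun j => (z j : ℂ) : Finset ℂ) := by
        rintro a ⟨ha, har⟩
        have har' : -r ≤ a.re := har
        have hre : a = (a.re : ℂ) := Complex.ext rfl (kummerM_eq_zero hb hx ha).1
        obtain ⟨j, hj, hja⟩ := hall a.re (by linarith) (by rw [← hre]; exact ha)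
        rw [Finset.coe_image]
        refine ⟨j, ?_, by simp only [← hja, ← hre]⟩
        rw [Finset.mem_coe, Finset.mem_range]
        refine lt_of_le_of_ne hj fun h => ?_
        rw [h] at hja
        linarith
      have h1 := h.trans (Set.encard_le_encard hsub)
      rw [Set.encard_coe_eq_coe_finsetCard] at h1
      have h2 := Nat.cast_le.1 h1
      have h3 := h2.trans Finset.card_image_le
      simp at h3
    · intro h
      have hinj : Set.InjOn (fun j => (z j : ℂ)) (Finset.range (k + 1) : Finset ℕ) := by
        intro i hi j hj hij
        have hij' : z i = z j := Complex.ofReal_injective hij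
        simp only [Finset.coe_range, Set.mem_Iio] at hi hj
        rcases lt_trichotomy i j with h | h | h
        · exact absurd hij' (hz i j h (by omega)).ne'
        · exact h
        · exact absurd hij' (hz j i h (by omega)).ne
      have hsub : (((Finset.range (k + 1)).image fun j => (z j : ℂ) : Finset ℂ) : Set ℂ)
          ⊆ kummerZeros b x ∩ {a : ℂ | -r ≤ a.re} := by
        rw [Finset.coe_image]
        rintro _ ⟨j, hj, rfl⟩
        simp only [Finset.coe_range, Set.mem_Iio] at hj
        refine ⟨hz0 j (by omega), ?_⟩
        simp only [Set.mem_ofPred_eq, Complex.ofReal_re]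
        rcases (Nat.lt_succ_iff.1 hj).lt_or_eq with h1 | rfl
        · linarith [hz j k h1 le_rfl]
        · linarith
      refine le_trans ?_ (Set.encard_le_encard hsub)
      rw [Set.encard_coe_eq_coe_finsetCard, Finset.card_image_of_injOn hinj, Finset.card_range]
  rw [kummerZero, hset, csInf_Ici]

theorem eventually_kummerZero {b : ℝ} (hb : 0 < b) (k : ℕ) :
    ∀ᶠ δ : ℝ in nhdsWithin 0 (Set.Ioi 0), ∀ᶠ x : ℝ in atTop,
      |kummerZero b k x - k| < δ ∧ kummerM (-(kummerZero b k x : ℂ)) b x = 0 := by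
  have h := (Filter.eventually_all_finset (Finset.range (k + 1))).2
    fun j _ => eventually_existsUnique_zero hb j
  -- With δ < 1/4 the intervals around the integers are disjoint, and the cutoff -(k+1/2) lies below
  -- the k-th zero.
  filter_upwards [h, Ioo_mem_nhdsGT (by norm_num : (0 : ℝ) < 1 / 4)] with δ hδ hδ'
  filter_upwards [(Filter.eventually_all_finset (Finset.range (k + 1))).2 hδ,
    eventually_ne_zero_of_far hb (-(k + 1 / 2)) hδ'.1, eventually_gt_atTop 0] with x hx hfar hx0
  have hx' : ∀ j : ℕ, ∃ t : ℝ, j ≤ k → (|t + j| < δ ∧ kummerM t b x = 0) ∧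
      ∀ u : ℝ, |u + j| < δ ∧ kummerM u b x = 0 → u = t := by
    intro j
    by_cases hj : j ≤ k
    · obtain ⟨t, ht⟩ := hx j (Finset.mem_range.2 (by omega))
      exact ⟨t, fun _ => ht⟩
    · exact ⟨0, fun h => absurd h hj⟩
  choose z hz using hx'
  have hzb : ∀ j ≤ k, -1 / 4 < z j + j ∧ z j + j < 1 / 4 := fun j hj => by
    have := abs_lt.1 (hz j hj).1.1
    constructor <;> linarith [hδ'.2]
  have hs : kummerZero b k x = -z k := by
    refine kummerZero_eq hb hx0 (fun i j hij hj => ?_) (fun j hj => (hz j hj).1.2) fun t ht h0 => ?_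
    · have h1 := hzb i (by omega)
      have h2 := hzb j hj
      have h3 : (i : ℝ) + 1 ≤ j := by exact_mod_cast hij
      linarith [h1.1, h2.2]
    · have h1 : ¬ ∀ n : ℕ, δ ≤ |t + n| := fun hf =>
        hfar t (by linarith [(hzb k le_rfl).1]) hf h0
      push Not at h1
      obtain ⟨n, hn⟩ := h1
      have hnk : n ≤ k := by
        have h2 := (abs_lt.1 hn).2
        have h3 := (hzb k le_rfl).1
        have h4 : (n : ℝ) < k + 1 := by linarith [hδ'.2]
        have h5 : n < k + 1 := by exact_mod_cast h4
        omega
      exact ⟨n, hnk, (hz n hnk).2 t ⟨hn, h0⟩⟩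
  rw [hs]
  refine ⟨?_, ?_⟩
  · rw [← abs_neg]
    convert (hz k le_rfl).1.1 using 2
    ring
  · simpa using (hz k le_rfl).1.2

theorem tendsto_kummerZero {b : ℝ} (hb : 0 < b) (k : ℕ) :
    Tendsto (kummerZero b k) atTop (nhds k) := by
  rw [Metric.tendsto_nhds]
  intro ε hε
  obtain ⟨δ, h1, h2⟩ := ((eventually_kummerZero hb k).and (Ioo_mem_nhdsGT hε)).exists
  filter_upwards [h1] with x hx
  rw [Real.dist_eq]
  exact hx.1.trans h2.2

theorem eventually_kummerM_kummerZero {b : ℝ} (hb : 0 < b) (k : ℕ) :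
    ∀ᶠ x : ℝ in atTop, kummerM (-(kummerZero b k x : ℂ)) b x = 0 := by
  obtain ⟨δ, h1⟩ := (eventually_kummerZero hb k).exists
  filter_upwards [h1] with x hx using hx.2

/-! ### Asymptotics of the summands -/

theorem deriv_kummerNormalized {b x : ℝ} (hb : 0 < b) (hx : 0 < x) {a : ℂ}
    (h : kummerM a b x = 0) : deriv (fun a => kummerNormalized b a x) a
      = Complex.exp (-x) * (x : ℂ) ^ ((b : ℂ) - a) * kummerMDeriv a b x := by
  have hx0 : (x : ℂ) ≠ 0 := by exact_mod_cast hx.ne'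
  have h1 : DifferentiableAt ℂ (fun a : ℂ => Complex.exp (-x) * (x : ℂ) ^ ((b : ℂ) - a)) a :=
    (differentiableAt_const _).mul
      (((differentiableAt_const _).sub differentiableAt_id).const_cpow (Or.inl hx0))
  have h2 := (h1.hasDerivAt.mul (differentiable_kummerM_fst hb x a).hasDerivAt).deriv
  simp only [h, mul_zero, zero_add] at h2
  exact h2

theorem tendsto_deriv_at_kummerZero {b : ℝ} (hb : 0 < b) (k : ℕ) :
    Tendsto (fun x : ℝ => deriv (fun a => kummerNormalized b a x) (-(kummerZero b k x : ℂ))) atTop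
      (nhds (deriv (kummerLimit b) (-(k : ℂ)))) := by
  rw [Metric.tendsto_nhds]
  intro ε hε
  obtain ⟨r, hr, h⟩ := kummerNormalized_strict_deriv hb k (half_pos hε)
  have hs := Metric.tendsto_nhds.1 (tendsto_kummerZero hb k) r hr
  filter_upwards [h, hs] with x hx hsx
  have h1 := hx.1 (-(kummerZero b k x : ℂ)) (by
    rw [Metric.mem_ball, dist_neg_neg]
    simpa [Complex.dist_of_im_eq] using hsx)
  rw [dist_eq_norm]
  linarith

theorem eventually_kummerMDeriv_ne_zero {b : ℝ} (hb : 0 < b) (k : ℕ) :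
    ∀ᶠ x : ℝ in atTop, kummerMDeriv (-(kummerZero b k x : ℂ)) b x ≠ 0 := by
  have h := (tendsto_deriv_at_kummerZero hb k).eventually_ne
    (deriv_kummerLimit_neg_nat_ne_zero hb k)
  filter_upwards [h, eventually_kummerM_kummerZero hb k, eventually_gt_atTop 0] with x hx h0 hx0
  rw [deriv_kummerNormalized hb hx0 h0] at hx
  exact right_ne_zero_of_mul hx

theorem eventually_kummerZero_pos {b : ℝ} (hb : 0 < b) (k : ℕ) :
    ∀ᶠ x : ℝ in atTop, 0 < kummerZero b k x := by
  filter_upwards [eventually_kummerM_kummerZero hb k, eventually_gt_atTop 0] with x h0 hx0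
  simpa using (kummerM_eq_zero hb hx0 h0).2

/-- `f(-k, x) = f'(-k) (s_k - k) + o(s_k - k)`. -/
theorem kummerNormalized_neg_nat_isLittleO {b : ℝ} (hb : 0 < b) (k : ℕ) :
    (fun x : ℝ => kummerNormalized b (-(k : ℂ)) x
        - deriv (kummerLimit b) (-(k : ℂ)) * ((kummerZero b k x : ℂ) - k))
      =o[atTop] fun x => (kummerZero b k x : ℂ) - k := by
  rw [isLittleO_iff]
  intro ε hε
  obtain ⟨r, hr, h⟩ := kummerNormalized_strict_deriv hb k hε
  have hs := Metric.tendsto_nhds.1 (tendsto_kummerZero hb k) r hr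
  filter_upwards [h, hs, eventually_kummerM_kummerZero hb k, eventually_gt_atTop 0]
    with x hx hsx h0 hx0
  have h1 := hx.2 (-(k : ℂ)) (Metric.mem_ball_self hr) (-(kummerZero b k x : ℂ)) (by
    rw [Metric.mem_ball, dist_neg_neg]
    simpa [Complex.dist_of_im_eq] using hsx)
  rw [(kummerNormalized_eq_zero_iff b _ hx0).2 h0, sub_zero, sub_neg_eq_add, neg_add_eq_sub] at h1
  exact h1

/-- Since g'(-k) ≠ 0, the linearisation bounds s_k - k by f(-k,x), which is O(x^{-1/2}) because
g(-k) = 0. Any negative power suffices: only (s_k - k) log x → 0 is used. -/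
theorem kummerZero_sub_isBigO {b : ℝ} (hb : 0 < b) (k : ℕ) :
    (fun x : ℝ => kummerZero b k x - k) =O[atTop] fun x : ℝ => x ^ (-(1 / 2) : ℝ) := by
  have hc := deriv_kummerLimit_neg_nat_ne_zero hb k
  have h1 : (fun x : ℝ => (kummerZero b k x : ℂ) - k)
      =O[atTop] fun x => kummerNormalized b (-(k : ℂ)) x := by
    have h2 : (fun x : ℝ => (kummerZero b k x : ℂ) - k) =Θ[atTop]
        fun x => deriv (kummerLimit b) (-(k : ℂ)) * ((kummerZero b k x : ℂ) - k) :=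
      (IsTheta.const_mul_left hc (isTheta_refl _ _)).symm
    exact h2.1.trans (IsEquivalent.isBigO_symm
      ((kummerNormalized_neg_nat_isLittleO hb k).trans_isBigO h2.1))
  have h2 : (fun x : ℝ => kummerNormalized b (-(k : ℂ)) x) =O[atTop]
      fun x : ℝ => x ^ (-(1 / 2) : ℝ) := by
    obtain ⟨C, X, hC, hX, h⟩ := exists_norm_kummerNormalized_sub_le hb (norm_nonneg (-(k : ℂ)))
    refine IsBigO.of_bound C ?_
    filter_upwards [eventually_ge_atTop X] with x hx
    have hx0 : 0 < x := by linarith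
    have h3 := le_of_tendsto ((tendsto_kummerNormalized hb (-(k : ℂ))).sub_const
      (kummerNormalized b (-(k : ℂ)) x)).norm (by
        filter_upwards [eventually_ge_atTop x] with y hy using h _ le_rfl x hx y hy)
    rw [kummerLimit_neg_nat hb, zero_sub, norm_neg] at h3
    rwa [Real.norm_of_nonneg (Real.rpow_nonneg hx0.le _)]
  have h3 := h1.trans h2
  refine isBigO_norm_left.1 ((isBigO_norm_left.2 h3).congr_left fun x => ?_)
  rw [← Complex.ofReal_natCast, ← Complex.ofReal_sub, Complex.norm_real]

theorem tendsto_rpow_kummerZero_sub {b : ℝ} (hb : 0 < b) (k : ℕ) :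
    Tendsto (fun x : ℝ => x ^ (kummerZero b k x - k)) atTop (nhds 1) := by
  have h1 : Tendsto (fun x : ℝ => Real.log x * (kummerZero b k x - k)) atTop (nhds 0) := by
    have h2 : (fun x : ℝ => Real.log x * (kummerZero b k x - k)) =O[atTop]
        fun x : ℝ => Real.log x * x ^ (-(1 / 2) : ℝ) :=
      (isBigO_refl _ _).mul (kummerZero_sub_isBigO hb k)
    refine h2.trans_tendsto ?_
    have h3 := (isLittleO_log_rpow_atTop (by norm_num : (0 : ℝ) < 1 / 2)).tendsto_div_nhds_zero
    refine h3.congr' ?_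
    filter_upwards [eventually_gt_atTop 0] with x hx
    rw [Real.rpow_neg hx.le, div_eq_mul_inv]
  have h2 := (Real.continuous_exp.tendsto 0).comp h1
  rw [Real.exp_zero] at h2
  refine h2.congr' ?_
  filter_upwards [eventually_gt_atTop 0] with x hx
  rw [Real.rpow_def_of_pos hx]
  rfl

/-- At a zero the product rule leaves only M' in ∂f/∂a, so M' can be exchanged for ∂f/∂a, and
x^{b+s_k} splits as x^{s_k-k} x^{k+b}. -/
theorem eventually_kummerSummand_eq {lam b y : ℝ} (hb : 0 < b) (k : ℕ) :
    ∀ᶠ x : ℝ in atTop, kummerSummand lam b y k x =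
      Complex.exp (-(lam * kummerZero b k x)) / (kummerZero b k x : ℂ) *
        kummerM (-(kummerZero b k x : ℂ)) b y * ((x ^ (kummerZero b k x - k) : ℝ) : ℂ) /
        deriv (fun a => kummerNormalized b a x) (-(kummerZero b k x : ℂ)) *
        ((x ^ ((k : ℝ) + b) * Real.exp (-x) : ℝ) : ℂ) := by
  filter_upwards [eventually_kummerM_kummerZero hb k, eventually_gt_atTop 0,
    eventually_kummerMDeriv_ne_zero hb k] with x h0 hx hM
  have e1 : (x : ℂ) ^ ((b : ℂ) - -(kummerZero b k x : ℂ))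
      = ((x ^ (kummerZero b k x - k) : ℝ) : ℂ) * ((x ^ ((k : ℝ) + b) : ℝ) : ℂ) := by
    rw [← Complex.ofReal_mul, ← Real.rpow_add hx, Complex.ofReal_cpow hx.le]
    congr 1
    push_cast; ring
  have h1 : ((x ^ (kummerZero b k x - k) : ℝ) : ℂ) ≠ 0 := by
    exact_mod_cast (Real.rpow_pos_of_pos hx _).ne'
  have h2 : ((x ^ ((k : ℝ) + b) : ℝ) : ℂ) ≠ 0 := by
    exact_mod_cast (Real.rpow_pos_of_pos hx _).ne'
  have h3 := Complex.exp_ne_zero (-(x : ℂ))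
  rw [deriv_kummerNormalized hb hx h0, e1, kummerSummand, Complex.ofReal_mul, Complex.ofReal_exp,
    Complex.ofReal_neg]
  field_simp

theorem tendsto_kummerZero_complex {b : ℝ} (hb : 0 < b) (k : ℕ) :
    Tendsto (fun x : ℝ => (kummerZero b k x : ℂ)) atTop (nhds k) := by
  have := (Complex.continuous_ofReal.tendsto _).comp (tendsto_kummerZero hb k)
  simpa [Function.comp_def] using this

/-- The factor `e^{-λ s} M(-s,b,y) x^{s-k} / f'(-s)` of the summand converges. -/
theorem tendsto_kummerSummand_factor {b y : ℝ} (lam : ℝ) (hb : 0 < b) (k : ℕ) :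
    Tendsto (fun x : ℝ => Complex.exp (-(lam * kummerZero b k x)) *
        kummerM (-(kummerZero b k x : ℂ)) b y * ((x ^ (kummerZero b k x - k) : ℝ) : ℂ) /
        deriv (fun a => kummerNormalized b a x) (-(kummerZero b k x : ℂ))) atTop
      (nhds (Complex.exp (-(lam * k)) * kummerM (-(k : ℂ)) b y /
        deriv (kummerLimit b) (-(k : ℂ)))) := by
  have hs := tendsto_kummerZero_complex hb k
  have h1 : Tendsto (fun x : ℝ => Complex.exp (-(lam * kummerZero b k x))) atTop
      (nhds (Complex.exp (-(lam * k)))) :=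
    (Complex.continuous_exp.tendsto _).comp (hs.const_mul _).neg
  have h2 : Tendsto (fun x : ℝ => kummerM (-(kummerZero b k x : ℂ)) b y) atTop
      (nhds (kummerM (-(k : ℂ)) b y)) :=
    ((differentiable_kummerM_fst hb y).continuous.tendsto _).comp hs.neg
  have h3 := (Complex.continuous_ofReal.tendsto _).comp (tendsto_rpow_kummerZero_sub hb k)
  have h4 := ((h1.mul h2).mul h3).div (tendsto_deriv_at_kummerZero hb k)
    (deriv_kummerLimit_neg_nat_ne_zero hb k)
  rw [Complex.ofReal_one, mul_one] at h4
  exact h4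

/-- Here x^b e^{-x} is f(0,x) itself, and f(0,x)/s_0 → g'(0) cancels the limit of the denominator
∂f/∂a. -/
theorem tendsto_kummerSummand_zero {lam b y : ℝ} (hb : 0 < b) :
    Tendsto (fun x : ℝ => kummerSummand lam b y 0 x) atTop (nhds 1) := by
  have hc := deriv_kummerLimit_neg_nat_ne_zero hb 0
  have h1 := (kummerNormalized_neg_nat_isLittleO hb 0).tendsto_div_nhds_zero
  have h2 : Tendsto (fun x : ℝ => kummerNormalized b 0 x / (kummerZero b 0 x : ℂ)) atTop
      (nhds (deriv (kummerLimit b) (-((0 : ℕ) : ℂ)))) := by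
    have h3 := h1.add_const (deriv (kummerLimit b) (-((0 : ℕ) : ℂ)))
    rw [zero_add] at h3
    refine h3.congr' ?_
    filter_upwards [eventually_kummerZero_pos hb 0] with x hx
    have : (kummerZero b 0 x : ℂ) ≠ 0 := by exact_mod_cast hx.ne'
    simp only [Nat.cast_zero, neg_zero, sub_zero]
    field_simp
    ring
  have h3 := (tendsto_kummerSummand_factor (y := y) lam hb 0).mul h2
  rw [div_mul_cancel₀ _ hc] at h3
  simp only [Nat.cast_zero, neg_zero, mul_zero, Complex.exp_zero, kummerM_zero_fst, one_mul] at h3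
  refine h3.congr' ?_
  filter_upwards [eventually_kummerSummand_eq (lam := lam) (y := y) hb 0,
    eventually_gt_atTop 0] with x hx hx0
  rw [hx, kummerNormalized_zero]
  push_cast [Complex.ofReal_cpow hx0.le]
  simp only [zero_add]
  ring

theorem kummerSummand_isLittleO {lam b y : ℝ} (hb : 0 < b) {k : ℕ} (hk : 1 ≤ k) :
    (fun x : ℝ => kummerSummand lam b y k x -
        (-1) ^ k * kummerM (-(k : ℂ)) b y /
          ((Real.exp (lam * k) * k * k.factorial * Real.Gamma b : ℝ) : ℂ) *
        ((x ^ ((k : ℝ) + b) * Real.exp (-x) : ℝ) : ℂ))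
      =o[atTop] fun x : ℝ => x ^ ((k : ℝ) + b) * Real.exp (-x) := by
  have hk0 : (k : ℂ) ≠ 0 := by exact_mod_cast (by omega : k ≠ 0)
  set L : ℂ := (-1) ^ k * kummerM (-(k : ℂ)) b y /
    ((Real.exp (lam * k) * k * k.factorial * Real.Gamma b : ℝ) : ℂ) with hL
  have hL' : Complex.exp (-(lam * k)) * kummerM (-(k : ℂ)) b y /
      deriv (kummerLimit b) (-(k : ℂ)) / k = L := by
    rw [hL, deriv_kummerLimit_neg_nat hb, Complex.exp_neg]
    have h1 : (k.factorial : ℂ) ≠ 0 := by exact_mod_cast k.factorial_ne_zero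
    have h2 : (Real.Gamma b : ℂ) ≠ 0 := by exact_mod_cast (Real.Gamma_pos_of_pos hb).ne'
    have h3 : (-1 : ℂ) ^ k ≠ 0 := pow_ne_zero _ (by norm_num)
    -- The sign of g'(-k) moves from the denominator to the numerator.
    have h4 : ((-1 : ℂ) ^ k) * (-1) ^ k = 1 := by rw [← mul_pow]; simp
    have h5 := Complex.exp_ne_zero (lam * k)
    push_cast
    field_simp
    linear_combination (-kummerM (-(k : ℂ)) b y) * h4
  have hB := (tendsto_kummerSummand_factor (y := y) lam hb k).div (tendsto_kummerZero_complex hb k) hk0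
  rw [hL'] at hB
  have hB0 := hB.sub_const L
  rw [sub_self] at hB0
  have h1 : (fun x : ℝ => ((x ^ ((k : ℝ) + b) * Real.exp (-x) : ℝ) : ℂ)) =O[atTop]
      fun x : ℝ => x ^ ((k : ℝ) + b) * Real.exp (-x) :=
    Complex.isBigO_ofReal_left.2 (isBigO_refl _ _)
  have h2 := h1.mul_isLittleO ((isLittleO_one_iff ℝ).2 hB0)
  simp only [mul_one] at h2
  refine h2.congr' ?_ (EventuallyEq.refl _ _)
  filter_upwards [eventually_kummerSummand_eq (lam := lam) (y := y) hb k] with x hx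
  rw [hx]
  simp only [Pi.div_apply]
  ring

theorem mainTheorem8 (lam b y : ℝ) (hlam : 0 < lam) (hb : 0 < b) (hy : 0 < y) :
    -- for large `x`, `-s_k` is a zero, and no denominator in the summand vanishes
    (∀ k : ℕ, ∀ᶠ x : ℝ in atTop,
      0 < kummerZero b k x ∧
      kummerM (-(kummerZero b k x : ℂ)) b x = 0 ∧
      kummerMDeriv (-(kummerZero b k x : ℂ)) b x ≠ 0) ∧
    -- the summand `k = 0`
    Tendsto (fun x : ℝ => kummerSummand lam b y 0 x) atTop (nhds 1) ∧
    -- the summands `k ≥ 1`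
    (∀ k : ℕ, 1 ≤ k →
      (fun x : ℝ => kummerSummand lam b y k x -
          (-1) ^ k * kummerM (-(k : ℂ)) b y /
            ((Real.exp (lam * k) * k * k.factorial * Real.Gamma b : ℝ) : ℂ) *
          ((x ^ ((k : ℝ) + b) * Real.exp (-x) : ℝ) : ℂ))
        =o[atTop] fun x : ℝ => x ^ ((k : ℝ) + b) * Real.exp (-x)) := by
  refine ⟨fun k => ?_, tendsto_kummerSummand_zero hb, fun k hk => kummerSummand_isLittleO hb hk⟩
  filter_upwards [eventually_kummerZero_pos hb k, eventually_kummerM_kummerZero hb k,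
    eventually_kummerMDeriv_ne_zero hb k] with x h1 h2 h3 using ⟨h1, h2, h3⟩
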